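/- All logarithms and entropies are to base $2$; $H_b(q)=-q\log q-(1-q)\log(1-q)$. Let $\mathcal S,\mathcal Y$ be finite, $P_S$ a distribution on $\mathcal S$, $P_{Y|S,X}$ a memoryless channel with state $s\in\mathcal S$, input $x\in\mathbb F_2$ and output in $\mathcal Y$, and $R>0$. **The code.** For $\mathbf q\in[0,1]^n$, $\mathbf u\in\mathbb F_2^n$ put $w_{\mathbf q}(\mathbf u)=\prod_i q_i^{u_i}(1-q_i)^{1-u_i}$, and for an invertible $\mathbf H\in\mathbb F_2^{n\times n}$ let $f_{\mathbf H}(\mathbf p,\mathbf q)\in\operatorname{argmax}_{\mathbf x\in\mathbb F_2^n}w_{\mathbf p}(\mathbf x)\,w_{\mathbf q}(\mathbf x\mathbf H^T)$, ties being broken in an arbitrary fixed way. Let $k=\lfloor nR\rfloor$. Given functions $p_e:\mathcal S\to[0,1]$, $p_d:\mathcal Y\to[0,1]$ and a finitely supported distribution $P_Q$ on $[0,1]$ that is symmetric about $1/2$, the weighted parity-check code is as follows. The encoder and the decoder share $\mathbf H$, uniform on the invertible $n\times n$ matrices over $\mathbb F_2$, and $\mathbf q=(q_1,\dots,q_{n-k})$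 with $q_i\sim P_Q$ i.i.d. The message $\mathbf m$ is uniform on $\mathbb F_2^k$, the state sequence $\mathbf s$ is i.i.d. $\sim P_S$, and $\mathbf H,\mathbf q,\mathbf m,\mathbf s$ are independent. The encoder sends $\mathbf x=f_{\mathbf H}([p_e(s_1),\dots,p_e(s_n)],[\mathbf m,\mathbf q])$; the decoder receives $\mathbf y$, forms $\hat{\mathbf x}=f_{\mathbf H}([p_d(y_1),\dots,p_d(y_n)],[\tfrac12,\dots,\tfrac12,\mathbf q])$, and outputs the first $k$ bits $\hat{\mathbf m}$ of $\hat{\mathbf x}\mathbf H^T$. **(1)** Let $P_{X|S}$ be a conditional distribution on $\mathbb F_2$ given $\mathcal S$, let $(S,X,Y)\sim P_SP_{X|S}P_{Y|S,X}$, and take $p_e(s)=P_{X|S}(1|s)$, $p_d(y)=P_{X|Y}(1|y)$. Suppose that $$\mathbf E[H_b(Q)]=\frac{1-H(X|S)}{1-R},\qquad R<I(X;Y)-I(X;S).$$ Exclude the degenerate case in which both $P_{X|S}(1|S)$ and $Q$ take values only in $\{0,\tfrac12,1\}$ (almost surely) and $P_{X|S}(1|S)\in\{0,1\}$ with positive probability.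 Then, as $n\to\infty$, the error probability $\mathbf P(\hat{\mathbf m}\ne\mathbf m)$ tends to $0$, and the empirical joint distribution of $\{(s_i,x_i)\}_{i\le n}$ tends to $P_SP_{X|S}$ in probability. **(2)** Consequently the code achieves the Gelfand–Pinsker rate with binary auxiliary: for a memoryless state channel $P_{Y|S,A}$ with any input alphabet $\mathcal A$, if $R<\sup\,(I(U;Y)-I(U;S))$, the supremum being over $P_{U|S}$ with $U\in\mathbb F_2$ and maps $g:\mathbb F_2\times\mathcal S\to\mathcal A$ (channel input $g(U,S)$), then there are $P_{U|S}$, $g$ and $P_Q$ as above with $\mathbf E[H_b(Q)]=(1-H(U|S))/(1-R)$ for which the code for the channel $P_{Y|S,A}(\cdot|s,g(u,s))$ (with $U$ in the role of $X$) has both properties in (1). This supremum is the Gelfand–Pinsker capacity whenever a binary auxiliary is optimal. **(3)** In particular, for any (possibly asymmetric) binary-input channel $P_{Y|X}$ without state and any $R<\sup_{P_X}I(X;Y)$, there are $P_X$ and $P_Q$ as above with $\mathbf E[H_b(Q)]=(1-H(X))/(1-R)$ for which the code (with constant state) has both properties in (1). -/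

import Mathlib

namespace WPC

/-! ### Finite distributions and information quantities (logarithms to base 2)

A distribution on a finite type `A` is an element of `stdSimplex ℝ A`. -/

/-- A channel (conditional distribution) from `A` to the finite alphabet `B`. -/
def IsKernel {A B : Type*} [Fintype B] (K : A → B → ℝ) : Prop :=
  ∀ a, K a ∈ stdSimplex ℝ B

/-- A channel with state: the conditional distribution of the output given state and input. -/
def IsStateChannel {S A Y : Type*} [Fintype Y] (W : S → A → Y → ℝ) : Prop :=
  ∀ s, IsKernel (W s)

/-- Shannon entropy in bits. -/
noncomputable def entropy {A : Type*} [Fintype A] (p : A → ℝ) : ℝ :=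
  -∑ a, p a * Real.logb 2 (p a)

/-- `H(X|S) = ∑ₛ P_S(s) H(P_{X|S}(·|s))`. -/
noncomputable def condEntropy {S A : Type*} [Fintype S] [Fintype A]
    (PS : S → ℝ) (PX : S → A → ℝ) : ℝ :=
  ∑ s, PS s * entropy (PX s)

/-- Mutual information `H(A) + H(B) - H(A,B)` of a joint distribution `J` on `A × B`. -/
noncomputable def mutualInfo {A B : Type*} [Fintype A] [Fintype B] (J : A → B → ℝ) : ℝ :=
  entropy (fun a => ∑ b, J a b) + entropy (fun b => ∑ a, J a b)
    - entropy (fun ab : A × B => J ab.1 ab.2)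

/-- Joint distribution of `(X, S)`. -/
def jointXS {S U : Type*} (PS : S → ℝ) (PX : S → U → ℝ) : U → S → ℝ :=
  fun x s => PS s * PX s x

/-- Joint distribution of `(X, Y)` when `S ∼ P_S`, `X|S ∼ P_{X|S}`, `Y|(S,X) ∼ W`. -/
def jointXY {S U Y : Type*} [Fintype S] (PS : S → ℝ) (PX : S → U → ℝ)
    (W : S → U → Y → ℝ) : U → Y → ℝ :=
  fun x y => ∑ s, PS s * PX s x * W s x y

/-- The Gelfand–Pinsker rate `I(X;Y) - I(X;S)`. -/
noncomputable def gpRate {S U Y : Type*} [Fintype S] [Fintype U] [Fintype Y]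
    (PS : S → ℝ) (PX : S → U → ℝ) (W : S → U → Y → ℝ) : ℝ :=
  mutualInfo (jointXY PS PX W) - mutualInfo (jointXS PS PX)

/-- The channel seen by an auxiliary letter `u` when the physical input is `g u s`. -/
def auxChannel {S U A Y : Type*} (W : S → A → Y → ℝ) (g : U → S → A) : S → U → Y → ℝ :=
  fun s u => W s (g u s)

/-- The Gelfand–Pinsker expression `sup (I(U;Y) - I(U;S))` for the state channel `W`, the
supremum being over `P_{U|S}` and `x = g(u,s)` with `U` ranging in the alphabet `U`. -/
noncomputable def gelfandPinsker (U : Type*) {S A Y : Type*} [Fintype S] [Fintype U] [Fintype Y]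
    (PS : S → ℝ) (W : S → A → Y → ℝ) : ℝ :=
  sSup {r | ∃ (PU : S → U → ℝ) (g : U → S → A), IsKernel PU ∧ r = gpRate PS PU (auxChannel W g)}

/-- The Shannon capacity `sup I(X;Y)` of a (possibly asymmetric) channel without state. -/
noncomputable def shannonCapacity {A Y : Type*} [Fintype A] [Fintype Y] (W : A → Y → ℝ) : ℝ :=
  sSup {r | ∃ PX ∈ stdSimplex ℝ A, r = mutualInfo (fun x y => PX x * W x y)}

/-! ### The parity bias distribution -/

/-- `P_Q` (given by its finitely supported mass function) is a probability distribution on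
`[0,1]` which is symmetric about `1/2`. -/
structure IsParityBias (PQ : ℝ →₀ ℝ) : Prop where
  nonneg : ∀ q, 0 ≤ PQ q
  support_subset : ∀ q ∈ PQ.support, q ∈ Set.Icc (0 : ℝ) 1
  sum_eq_one : ∑ q ∈ PQ.support, PQ q = 1
  symm : ∀ q, PQ (1 - q) = PQ q

/-- `E[H_b(Q)]` in bits, for `Q ∼ P_Q`. -/
noncomputable def meanBinEntropy (PQ : ℝ →₀ ℝ) : ℝ :=
  ∑ q ∈ PQ.support, PQ q * (Real.binEntropy q / Real.log 2)

/-- Either some codeword bias `P_{X|S}(1|s)` or some parity bias is outside `{0, 1/2, 1}`,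
or no codeword bias is `0` or `1` (only `s`, `q` of positive probability count). -/
def NonDegenerate {S : Type*} (PS : S → ℝ) (PX : S → ZMod 2 → ℝ) (PQ : ℝ →₀ ℝ) : Prop :=
  (∃ s, PS s ≠ 0 ∧ PX s 1 ∉ ({0, 1 / 2, 1} : Set ℝ)) ∨
  (∃ q ∈ PQ.support, q ∉ ({0, 1 / 2, 1} : Set ℝ)) ∨
  (∀ s, PS s ≠ 0 → PX s 1 ∉ ({0, 1} : Set ℝ))

/-! ### Weighted parity-check codes -/

/-- The `q`-weight `∏ᵢ qᵢ^{uᵢ} (1-qᵢ)^{1-uᵢ}`. -/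
noncomputable def weight {n : ℕ} (q : Fin n → ℝ) (u : Fin n → ZMod 2) : ℝ :=
  ∏ i, if u i = 1 then q i else 1 - q i

/-- `x Hᵀ`. -/
def parity {n : ℕ} (H : GL (Fin n) (ZMod 2)) (x : Fin n → ZMod 2) : Fin n → ZMod 2 :=
  Matrix.vecMul x (Matrix.transpose (H : Matrix (Fin n) (Fin n) (ZMod 2)))

/-- Candidate query functions `f_H(p, q)`, for all blocklengths. -/
abbrev Query : Type :=
  (n : ℕ) → GL (Fin n) (ZMod 2) → (Fin n → ℝ) → (Fin n → ℝ) → (Fin n → ZMod 2)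

/-- `f_H(p, q)` is a maximizer of `w_p(x) w_q(x Hᵀ)`; ties may be broken in any way. -/
def IsQuery (f : Query) : Prop :=
  ∀ (n : ℕ) (H : GL (Fin n) (ZMod 2)) (p q : Fin n → ℝ) (x : Fin n → ZMod 2),
    weight p x * weight q (parity H x) ≤
      weight p (f n H p q) * weight q (parity H (f n H p q))

/-- The concatenation `[a, b]` of length `n` of `a` of length `k` and `b` of length `n - k`. -/
def concat {n k : ℕ} (a : Fin k → ℝ) (b : Fin (n - k) → ℝ) : Fin n → ℝ :=
  fun i => if h : (i : ℕ) < k then a ⟨i, h⟩ else b ⟨i - k, by omega⟩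

/-- The encoder: `(m, s) ↦ f_H([p_e(s₁),…,p_e(sₙ)], [m, q])`. -/
noncomputable def encode {S : Type*} (f : Query) (pe : S → ℝ) {n k : ℕ}
    (H : GL (Fin n) (ZMod 2)) (q : Fin (n - k) → ℝ) (m : Fin k → ZMod 2) (s : Fin n → S) :
    Fin n → ZMod 2 :=
  f n H (fun i => pe (s i)) (concat (fun j => if m j = 1 then 1 else 0) q)

/-- The decoder: the first `k` bits of `x̂ Hᵀ`, where
`x̂ = f_H([p_d(y₁),…,p_d(yₙ)], [1/2,…,1/2, q])`. It is used with `k ≤ n` only. -/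
noncomputable def decode {Y : Type*} (f : Query) (pd : Y → ℝ) {n k : ℕ}
    (H : GL (Fin n) (ZMod 2)) (q : Fin (n - k) → ℝ) (y : Fin n → Y) : Fin k → ZMod 2 :=
  fun j => if h : (j : ℕ) < n then
    parity H (f n H (fun i => pd (y i)) (concat (fun _ : Fin k => 1 / 2) q)) ⟨j, h⟩
  else 0

open Classical in
/-- Probability that `E m m̂ s x` holds when the message `m` is uniform on `𝔽₂ᵏ`, `H` is uniform
on the full-rank matrices, `qᵢ ∼ P_Q` i.i.d., `sᵢ ∼ P_S` i.i.d. (all independent), `x` is the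
codeword, `y` is the output of the memoryless channel `W` and `m̂` is the decoded message. -/
noncomputable def codeProb {S Y : Type*} [Fintype S] [Fintype Y] (f : Query)
    (PS : S → ℝ) (W : S → ZMod 2 → Y → ℝ) (PQ : ℝ →₀ ℝ) (pe : S → ℝ) (pd : Y → ℝ) (n k : ℕ)
    (E : (Fin k → ZMod 2) → (Fin k → ZMod 2) → (Fin n → S) → (Fin n → ZMod 2) → Prop) : ℝ :=
  ∑ m : Fin k → ZMod 2, ∑ H : GL (Fin n) (ZMod 2),
    ∑ q ∈ Fintype.piFinset (fun _ : Fin (n - k) => PQ.support), ∑ s : Fin n → S,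
      ∑ y : Fin n → Y,
        (1 / 2 ^ k) * (1 / (Fintype.card (GL (Fin n) (ZMod 2)) : ℝ)) * (∏ j, PQ (q j)) *
          (∏ i, PS (s i)) * (∏ i, W (s i) (encode f pe H q m s i) (y i)) *
          (if E m (decode f pd H q y) s (encode f pe H q m s) then 1 else 0)

/-- The empirical joint distribution of `(sᵢ, xᵢ)`, `i = 1, …, n`. -/
noncomputable def empirical {S : Type*} [DecidableEq S] {n : ℕ} (s : Fin n → S) (x : Fin n → ZMod 2)
    (a : S) (b : ZMod 2) : ℝ :=
  ((Finset.univ.filter (fun i => s i = a ∧ x i = b)).card : ℝ) / n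

/-- Codeword bias of the encoder: `p_e(s) = P_{X|S}(1|s)`. -/
def encBias {S : Type*} (PX : S → ZMod 2 → ℝ) : S → ℝ := fun s => PX s 1

/-- Codeword bias of the decoder: `p_d(y) = P_{X|Y}(1|y)` (`0` where `P_Y(y) = 0`). -/
noncomputable def decBias {S Y : Type*} [Fintype S] (PS : S → ℝ) (PX : S → ZMod 2 → ℝ)
    (W : S → ZMod 2 → Y → ℝ) : Y → ℝ :=
  fun y => jointXY PS PX W 1 y / ∑ x, jointXY PS PX W x y

/-- With message length `k = ⌊nR⌋`, `p_e = P_{X|S}(1|·)`, `p_d = P_{X|Y}(1|·)` and any tie-breaking,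
the error probability of the weighted parity-check code tends to `0`, and the empirical joint
distribution of `(sᵢ, xᵢ)` tends to `P_S P_{X|S}` in probability. -/
def Reliable {S Y : Type*} [Fintype S] [DecidableEq S] [Fintype Y] (R : ℝ)
    (PS : S → ℝ) (PX : S → ZMod 2 → ℝ) (W : S → ZMod 2 → Y → ℝ) (PQ : ℝ →₀ ℝ) : Prop :=
  ∀ f : Query, IsQuery f →
    Filter.Tendsto
      (fun n : ℕ => codeProb f PS W PQ (encBias PX) (decBias PS PX W) n ⌊(n : ℝ) * R⌋₊
        (fun m m' _ _ => m ≠ m'))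
      Filter.atTop (nhds 0) ∧
    ∀ ε : ℝ, 0 < ε → Filter.Tendsto
      (fun n : ℕ => codeProb f PS W PQ (encBias PX) (decBias PS PX W) n ⌊(n : ℝ) * R⌋₊
        (fun _ _ s x => ∃ a b, ε ≤ |empirical s x a b - PS a * PX a b|))
      Filter.atTop (nhds 0)

end WPC

/-!
The encoder and the decoder are analysed by a change of measure. A query maximizes a weight
`w(x)`; if its maximum is at least `θ`, then the indicator of `x` being the answer is at most
`w(x) / θ`, so any event has probability at most `P(no word has weight ≥ θ)` plus `1 / θ` times its
`w`-weighted count over all words. For a uniform invertible `H` and a fixed nonzero `x`, the vector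
`x Hᵀ` is uniform on the nonzero vectors, and for two distinct nonzero words the two parity vectors
are uniform on the pairs of distinct nonzero vectors. Averaged over `H`, the weighted count is
therefore `2⁻ⁿ` times the probability of the event under an ideal law, in which the pairs
`(sᵢ, xᵢ)` are i.i.d. `∼ P_S P_{X|S}` and the parity bits are independent of them with biases `qⱼ`.
For `θ = 2⁻ⁿ e^{-δn}` the loss is only `e^{δn}`, while atypical empirical distributions and
decoding errors have exponentially small ideal probability by Chernoff bounds; `δ` is chosen last.

It remains to see that the encoder finds a word of weight `2⁻ⁿ e^{-δn}`. The condition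
`H(X|S) + (1 - R) E[H_b(Q)] = 1` makes the typical weight of an ideal pair `2⁻ⁿ e^{o(n)}`. Moving
all biases other than `0` and `1` slightly towards `1/2` increases the entropy strictly, unless the
biases are all in `{0, 1/2, 1}`, so exponentially more than `2ⁿ` pairs `(x, v)` have such a weight,
and by the second moment method some `x` satisfies `x Hᵀ = v` for one of them.
-/

namespace WPC

open Finset Filter Topology
open scoped BigOperators

open Classical in
/-- The real-valued indicator of a proposition; it turns probabilities of events into
expectations. Decidability is classical, so that `ind` never carries an instance argument. -/
noncomputable def ind (p : Prop) : ℝ := if p then 1 else 0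

lemma ind_of_true {p : Prop} (h : p) : ind p = 1 := if_pos h

lemma ind_of_false {p : Prop} (h : ¬p) : ind p = 0 := if_neg h

lemma ind_eq_ite (p : Prop) [Decidable p] : ind p = if p then 1 else 0 := by
  by_cases h : p <;> simp [ind, h]

lemma ind_nonneg (p : Prop) : 0 ≤ ind p := by
  by_cases h : p <;> simp [ind, h]

lemma ind_le_one (p : Prop) : ind p ≤ 1 := by
  by_cases h : p <;> simp [ind, h]

lemma ind_mono {p q : Prop} (h : p → q) : ind p ≤ ind q := by
  by_cases hp : p
  · rw [ind_of_true hp, ind_of_true (h hp)]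
  · rw [ind_of_false hp]
    exact ind_nonneg q

lemma ind_or_le (p q : Prop) : ind (p ∨ q) ≤ ind p + ind q := by
  by_cases hp : p <;> by_cases hq : q <;> simp [ind, hp, hq]

lemma ind_and (p q : Prop) : ind (p ∧ q) = ind p * ind q := by
  by_cases hp : p <;> by_cases hq : q <;> simp [ind, hp, hq]

lemma ind_le_div {t w : ℝ} (ht : 0 < t) (hw : 0 ≤ w) : ind (t ≤ w) ≤ w / t := by
  by_cases h : t ≤ w
  · exact (ind_of_true h).trans_le ((one_le_div ht).2 h)
  · exact (ind_of_false h).trans_le (by positivity)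

/-! ### Uniform averages -/

lemma expect_smul_eq_expect {G X : Type*} [Group G] [Fintype G] [MulAction G X] {s : Finset X}
    (hs : ∀ (g : G), ∀ y ∈ s, g • y ∈ s) (htrans : ∀ y ∈ s, ∀ z ∈ s, ∃ g : G, g • y = z)
    (F : X → ℝ) {x : X} (hx : x ∈ s) :
    𝔼 g : G, F (g • x) = 𝔼 y ∈ s, F y := by
  have orbit_indep : ∀ y ∈ s, 𝔼 g : G, F (g • y) = 𝔼 g : G, F (g • x) := by
    intro y hy
    obtain ⟨h, rfl⟩ := htrans x hx y hy
    exact Fintype.expect_equiv (Equiv.mulRight h) _ _ fun g => by simp [mul_smul]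
  have translate (g : G) : 𝔼 y ∈ s, F (g • y) = 𝔼 y ∈ s, F y :=
    expect_nbij' (g • ·) (g⁻¹ • ·) (hs g) (hs g⁻¹) (fun y _ => inv_smul_smul g y)
      (fun y _ => smul_inv_smul g y) fun _ _ => rfl
  calc 𝔼 g : G, F (g • x)
      = 𝔼 y ∈ s, 𝔼 g : G, F (g • y) := by
        rw [expect_congr rfl orbit_indep, expect_const ⟨x, hx⟩]
    _ = 𝔼 g : G, 𝔼 y ∈ s, F (g • y) := expect_comm ..
    _ = 𝔼 y ∈ s, F y := by simp_rw [translate, Fintype.expect_const]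

lemma expect_ind_eq_zero_mul_sq_le {Ω : Type*} [Fintype Ω] [Nonempty Ω] (N : Ω → ℝ) :
    (𝔼 ω, ind (N ω = 0)) * (𝔼 ω, N ω) ^ 2 ≤ 𝔼 ω, N ω ^ 2 - (𝔼 ω, N ω) ^ 2 := by
  set μ := 𝔼 ω, N ω with hμ
  have chebyshev (ω : Ω) : ind (N ω = 0) * μ ^ 2 ≤ (N ω ^ 2 - 2 * μ * N ω) + μ ^ 2 := by
    by_cases h : N ω = 0
    · rw [ind_of_true h, h]
      linarith
    · rw [ind_of_false h]
      nlinarith [sq_nonneg (N ω - μ)]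
  calc (𝔼 ω, ind (N ω = 0)) * μ ^ 2
      = 𝔼 ω, ind (N ω = 0) * μ ^ 2 := expect_mul ..
    _ ≤ 𝔼 ω, (N ω ^ 2 - 2 * μ * N ω + μ ^ 2) := expect_le_expect fun ω _ => chebyshev ω
    _ = 𝔼 ω, N ω ^ 2 - μ ^ 2 := by
      rw [expect_add_distrib, expect_sub_distrib, Fintype.expect_const, ← mul_expect, ← hμ]
      ring

/-! ### The uniform distribution on `GL_n(𝔽₂)` -/

lemma exists_smul_eq {K m ι : Type*} [Field K] [Fintype m] [DecidableEq m] [Finite ι]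
    {v w : ι → m → K} (hv : LinearIndependent K v) (hw : LinearIndependent K w) :
    ∃ H : GL m K, ∀ i, H • v i = w i := by
  let f := hv.linearCombinationEquiv.symm ≪≫ₗ hw.linearCombinationEquiv
  have : FiniteDimensional K (Submodule.span K (Set.range v)) :=
    FiniteDimensional.span_of_finite _ (Set.finite_range _)
  obtain ⟨g, hg⟩ := Submodule.exists_linearEquiv_restrict_eq f
  let H := Matrix.GeneralLinearGroup.toLin.symm (LinearMap.GeneralLinearGroup.ofLinearEquiv g)
  have hH (x : m → K) : H • x = g x := by
    change Matrix.mulVec (H : Matrix m m K) x = g x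
    rw [← Matrix.mulVecLin_apply, ← Matrix.GeneralLinearGroup.coe_toLin, MulEquiv.apply_symm_apply]
    rfl
  refine ⟨H, fun i => ?_⟩
  let vi : Submodule.span K (Set.range v) := ⟨v i, Submodule.subset_span ⟨i, rfl⟩⟩
  have hvi : vi = hv.linearCombinationEquiv (Finsupp.single i 1) := by ext1; simp [vi]
  have hfvi : (f vi : m → K) = w i := by simp [f, hvi]
  exact (hH _).trans ((hg vi).symm.trans hfvi)

section Parity

variable {n : ℕ}

lemma parity_eq_smul (H : GL (Fin n) (ZMod 2)) : parity H = (H • ·) :=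
  funext fun x => Matrix.vecMul_transpose _ x

lemma parity_zero (H : GL (Fin n) (ZMod 2)) : parity H 0 = 0 := by
  simp [parity_eq_smul]

lemma parity_injective (H : GL (Fin n) (ZMod 2)) : Function.Injective (parity H) :=
  parity_eq_smul H ▸ MulAction.injective H

lemma linearIndependent_pair_of_ne {x y : Fin n → ZMod 2} (hx : x ≠ 0) (hy : y ≠ 0)
    (hxy : x ≠ y) : LinearIndependent (ZMod 2) ![x, y] := by
  refine (LinearIndependent.pair_iff' hx).2 fun a => ?_
  obtain rfl | rfl : a = 0 ∨ a = 1 := by revert a; decide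
  · rwa [zero_smul, ne_comm]
  · rwa [one_smul]

lemma card_erase_zero : (#((univ : Finset (Fin n → ZMod 2)).erase 0) : ℝ) = 2 ^ n - 1 := by
  rw [card_erase_of_mem (mem_univ _), card_univ, Fintype.card_fun, ZMod.card, Fintype.card_fin,
    Nat.cast_sub Nat.one_le_two_pow]
  norm_num

lemma card_offDiag_erase_zero :
    (#((univ : Finset (Fin n → ZMod 2)).erase 0).offDiag : ℝ) = (2 ^ n - 1) * (2 ^ n - 2) := by
  rw [offDiag_card, Nat.cast_sub (Nat.le_mul_self _), Nat.cast_mul, card_erase_zero]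
  ring

lemma four_le_two_pow (hn : 2 ≤ n) : (4 : ℝ) ≤ 2 ^ n :=
  calc (4 : ℝ) = 2 ^ 2 := by norm_num
    _ ≤ 2 ^ n := pow_le_pow_right₀ one_le_two hn

lemma expect_parity {x : Fin n → ZMod 2} (hx : x ≠ 0) (F : (Fin n → ZMod 2) → ℝ) :
    𝔼 H : GL (Fin n) (ZMod 2), F (parity H x) = (∑ z ∈ univ.erase 0, F z) / (2 ^ n - 1) := by
  simp_rw [parity_eq_smul]
  rw [← card_erase_zero, ← expect_eq_sum_div_card]
  refine expect_smul_eq_expect (fun H y hy => ?_) (fun y hy z hz => ?_) F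
    (mem_erase.2 ⟨hx, mem_univ _⟩)
  · exact mem_erase.2 ⟨(smul_ne_zero_iff_ne H).2 (ne_of_mem_erase hy), mem_univ _⟩
  · have hli {u : Fin n → ZMod 2} (hu : u ∈ univ.erase 0) :
        LinearIndependent (ZMod 2) fun _ : Unit => u :=
      linearIndependent_unique_iff.2 (ne_of_mem_erase hu)
    obtain ⟨H, hH⟩ := exists_smul_eq (hli hy) (hli hz)
    exact ⟨H, hH ()⟩

lemma expect_parity_pair {x x' : Fin n → ZMod 2} (hx : x ≠ 0) (hx' : x' ≠ 0) (hxx' : x ≠ x')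
    (F : (Fin n → ZMod 2) × (Fin n → ZMod 2) → ℝ) :
    𝔼 H : GL (Fin n) (ZMod 2), F (parity H x, parity H x') =
      (∑ z ∈ (univ.erase 0).offDiag, F z) / ((2 ^ n - 1) * (2 ^ n - 2)) := by
  have mem_iff (y : (Fin n → ZMod 2) × (Fin n → ZMod 2)) :
      y ∈ (univ.erase 0).offDiag ↔ y.1 ≠ 0 ∧ y.2 ≠ 0 ∧ y.1 ≠ y.2 := by simp [mem_offDiag]
  simp_rw [parity_eq_smul]
  rw [← card_offDiag_erase_zero, ← expect_eq_sum_div_card]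
  refine expect_smul_eq_expect (x := (x, x')) (fun H y hy => ?_) (fun y hy z hz => ?_) F
    ((mem_iff _).2 ⟨hx, hx', hxx'⟩)
  · obtain ⟨h1, h2, h12⟩ := (mem_iff _).1 hy
    exact (mem_iff _).2 ⟨(smul_ne_zero_iff_ne H).2 h1, (smul_ne_zero_iff_ne H).2 h2,
      (MulAction.injective H).ne h12⟩
  · obtain ⟨hy1, hy2, hy12⟩ := (mem_iff _).1 hy
    obtain ⟨hz1, hz2, hz12⟩ := (mem_iff _).1 hz
    obtain ⟨H, hH⟩ := exists_smul_eq (linearIndependent_pair_of_ne hy1 hy2 hy12)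
      (linearIndependent_pair_of_ne hz1 hz2 hz12)
    exact ⟨H, Prod.ext (hH 0) (hH 1)⟩

lemma expect_parity_le (hn : 2 ≤ n) {x : Fin n → ZMod 2} (hx : x ≠ 0)
    {F : (Fin n → ZMod 2) → ℝ} (hF : ∀ z, 0 ≤ F z) :
    𝔼 H : GL (Fin n) (ZMod 2), F (parity H x) ≤ (∑ z, F z) / (2 ^ n - 1) := by
  have : (0 : ℝ) < 2 ^ n - 1 := by linarith [four_le_two_pow hn]
  rw [expect_parity hx]
  gcongr
  exacts [fun z _ _ => hF z, subset_univ _]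

lemma expect_parity_mul_parity_le (hn : 2 ≤ n) {x x' : Fin n → ZMod 2} (hx : x ≠ 0)
    (hx' : x' ≠ 0) (hxx' : x ≠ x') {F G : (Fin n → ZMod 2) → ℝ} (hF : ∀ z, 0 ≤ F z)
    (hG : ∀ z, 0 ≤ G z) :
    𝔼 H : GL (Fin n) (ZMod 2), F (parity H x) * G (parity H x') ≤
      (∑ z, F z) * (∑ z, G z) / ((2 ^ n - 1) * (2 ^ n - 2)) := by
  have : (0 : ℝ) < (2 ^ n - 1) * (2 ^ n - 2) := by nlinarith [four_le_two_pow hn]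
  rw [expect_parity_pair hx hx' hxx' fun z => F z.1 * G z.2, sum_mul_sum,
    ← sum_product']
  gcongr
  exacts [fun z _ _ => mul_nonneg (hF _) (hG _), subset_univ _]

lemma expect_ind_parity_eq {x z : Fin n → ZMod 2} (hx : x ≠ 0) (hz : z ≠ 0) :
    𝔼 H : GL (Fin n) (ZMod 2), ind (parity H x = z) = 1 / (2 ^ n - 1) := by
  rw [expect_parity hx fun y => ind (y = z)]
  simp [ind_eq_ite, hz]

lemma expect_ind_parity_eq_mul_le (hn : 2 ≤ n) {a b : (Fin n → ZMod 2) × (Fin n → ZMod 2)}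
    (ha : a.1 ≠ 0) (hb : b.1 ≠ 0) (hab : a ≠ b) :
    𝔼 H : GL (Fin n) (ZMod 2), ind (parity H a.1 = a.2) * ind (parity H b.1 = b.2) ≤
      1 / ((2 ^ n - 1) * (2 ^ n - 2)) := by
  have : (0 : ℝ) < (2 ^ n - 1) * (2 ^ n - 2) := by nlinarith [four_le_two_pow hn]
  by_cases hab1 : a.1 = b.1
  · have incompatible (H : GL (Fin n) (ZMod 2)) :
        ind (parity H a.1 = a.2) * ind (parity H b.1 = b.2) = 0 := by
      rw [← ind_and]
      exact ind_of_false fun h => hab (Prod.ext hab1 (by rw [← h.1, ← h.2, hab1]))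
    simp_rw [incompatible, expect_const_zero]
    positivity
  · refine (expect_parity_mul_parity_le hn ha hb hab1 (F := fun z => ind (z = a.2))
      (G := fun z => ind (z = b.2)) (fun _ => ind_nonneg _) fun _ => ind_nonneg _).trans_eq ?_
    simp [ind_eq_ite]

lemma expect_sum_ind_parity_eq {G : Finset ((Fin n → ZMod 2) × (Fin n → ZMod 2))}
    (hG : ∀ a ∈ G, a.1 ≠ 0 ∧ a.2 ≠ 0) :
    𝔼 H : GL (Fin n) (ZMod 2), ∑ a ∈ G, ind (parity H a.1 = a.2) = #G / (2 ^ n - 1) := by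
  rw [expect_sum_comm, sum_congr rfl fun a ha => expect_ind_parity_eq (hG a ha).1 (hG a ha).2,
    sum_const, nsmul_eq_mul, mul_one_div]

lemma expect_sq_sum_ind_parity_eq_le (hn : 2 ≤ n)
    {G : Finset ((Fin n → ZMod 2) × (Fin n → ZMod 2))} (hG : ∀ a ∈ G, a.1 ≠ 0 ∧ a.2 ≠ 0) :
    𝔼 H : GL (Fin n) (ZMod 2), (∑ a ∈ G, ind (parity H a.1 = a.2)) ^ 2 ≤
      #G / (2 ^ n - 1) + #G ^ 2 / ((2 ^ n - 1) * (2 ^ n - 2)) := by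
  have hK : (0 : ℝ) < (2 ^ n - 1) * (2 ^ n - 2) := by nlinarith [four_le_two_pow hn]
  have pair_le : ∀ a ∈ G, ∀ b ∈ G,
      𝔼 H : GL (Fin n) (ZMod 2), ind (parity H a.1 = a.2) * ind (parity H b.1 = b.2) ≤
        (if a = b then 1 / (2 ^ n - 1) else 0) + 1 / ((2 ^ n - 1) * (2 ^ n - 2)) := by
    intro a ha b hb
    split_ifs with hab
    · subst hab
      simp_rw [← ind_and, and_self, expect_ind_parity_eq (hG a ha).1 (hG a ha).2]
      exact le_add_of_nonneg_right (by positivity)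
    · exact (expect_ind_parity_eq_mul_le hn (hG a ha).1 (hG b hb).1 hab).trans_eq (zero_add _).symm
  simp_rw [sq, sum_mul_sum, expect_sum_comm]
  refine (sum_le_sum fun a ha => sum_le_sum (pair_le a ha)).trans_eq ?_
  simp only [sum_add_distrib, sum_ite_eq, sum_ite_mem, inter_self, sum_const, nsmul_eq_mul]
  ring

lemma expect_ind_forall_parity_notMem_le (hn : 2 ≤ n)
    {G : Finset ((Fin n → ZMod 2) × (Fin n → ZMod 2))} (hG : ∀ a ∈ G, a.1 ≠ 0 ∧ a.2 ≠ 0)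
    (hne : G.Nonempty) :
    𝔼 H : GL (Fin n) (ZMod 2), ind (∀ x, (x, parity H x) ∉ G) ≤
      (2 ^ n - 1) / #G + 1 / (2 ^ n - 2) := by
  have hK : (0 : ℝ) < 2 ^ n - 1 := by linarith [four_le_two_pow hn]
  have hK' : (0 : ℝ) < 2 ^ n - 2 := by linarith [four_le_two_pow hn]
  have : (0 : ℝ) < #G := by exact_mod_cast hne.card_pos
  let N (H : GL (Fin n) (ZMod 2)) : ℝ := ∑ a ∈ G, ind (parity H a.1 = a.2)
  have missed (H : GL (Fin n) (ZMod 2)) (h : ∀ x, (x, parity H x) ∉ G) : N H = 0 :=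
    sum_eq_zero fun a ha => ind_of_false fun e => h a.1 (e ▸ ha)
  have variance := (expect_ind_eq_zero_mul_sq_le N).trans
    (sub_le_sub_right (expect_sq_sum_ind_parity_eq_le hn hG) _)
  rw [expect_sum_ind_parity_eq hG] at variance
  have ratio : (#G / (2 ^ n - 1) + #G ^ 2 / ((2 ^ n - 1) * (2 ^ n - 2)) -
      (#G / (2 ^ n - 1)) ^ 2 : ℝ) =
      ((2 ^ n - 1) / #G + 1 / (2 ^ n - 2)) * (#G / (2 ^ n - 1)) ^ 2 := by
    field_simp
    ring
  refine (expect_le_expect fun H _ => ind_mono (missed H)).trans ?_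
  exact le_of_mul_le_mul_right (variance.trans_eq ratio)
    (by positivity : (0 : ℝ) < (#G / (2 ^ n - 1)) ^ 2)

end Parity

/-! ### Product distributions on sequences -/

section ProdExpect

variable {ι A : Type*} [Fintype ι] [DecidableEq ι] [Fintype A]

/-- The expectation of `F a` when the letters `a i` are independent and `a i` has mass function
`p i`. The sequence `a` is i.i.d. when `p` is constant. -/
noncomputable def prodExpect (p : ι → A → ℝ) (F : (ι → A) → ℝ) : ℝ :=
  ∑ a, (∏ i, p i (a i)) * F a

lemma prodExpect_prod (p f : ι → A → ℝ) :
    prodExpect p (fun a => ∏ i, f i (a i)) = ∏ i, ∑ x, p i x * f i x := by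
  simp only [prodExpect, ← prod_mul_distrib]
  rw [prod_univ_sum, Fintype.piFinset_univ]

lemma prodExpect_add (p : ι → A → ℝ) (F G : (ι → A) → ℝ) :
    prodExpect p (fun a => F a + G a) = prodExpect p F + prodExpect p G := by
  simp only [prodExpect, mul_add, sum_add_distrib]

lemma prodExpect_mul_left (p : ι → A → ℝ) (c : ℝ) (F : (ι → A) → ℝ) :
    prodExpect p (fun a => c * F a) = c * prodExpect p F := by
  simp only [prodExpect, mul_left_comm _ c, ← mul_sum]

lemma prodExpect_mul_right (p : ι → A → ℝ) (F : (ι → A) → ℝ) (c : ℝ) :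
    prodExpect p (fun a => F a * c) = prodExpect p F * c := by
  simp only [mul_comm _ c, prodExpect_mul_left]

lemma prodExpect_sum {κ : Type*} (p : ι → A → ℝ) (s : Finset κ) (F : κ → (ι → A) → ℝ) :
    prodExpect p (fun a => ∑ j ∈ s, F j a) = ∑ j ∈ s, prodExpect p (F j) := by
  simp only [prodExpect, mul_sum]
  exact sum_comm

lemma prodExpect_expect {κ : Type*} (p : ι → A → ℝ) (s : Finset κ) (F : κ → (ι → A) → ℝ) :
    prodExpect p (fun a => 𝔼 j ∈ s, F j a) = 𝔼 j ∈ s, prodExpect p (F j) := by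
  simp only [prodExpect, mul_expect, expect_sum_comm]

lemma prodExpect_comm {κ B : Type*} [Fintype κ] [DecidableEq κ] [Fintype B] (p : ι → A → ℝ)
    (q : κ → B → ℝ) (F : (ι → A) → (κ → B) → ℝ) :
    prodExpect p (fun a => prodExpect q (F a)) = prodExpect q (fun b => prodExpect p (F · b)) := by
  simp only [prodExpect, mul_sum, mul_left_comm]
  exact sum_comm

section Kernel

variable {p : ι → A → ℝ} {F G : (ι → A) → ℝ}

lemma prodExpect_const (hp : IsKernel p) (c : ℝ) : prodExpect p (fun _ => c) = c := by
  have h := prodExpect_prod p (fun _ _ => 1)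
  simp only [prod_const_one, mul_one, (hp _).2] at h
  simpa only [mul_one, h] using prodExpect_mul_left p c (fun _ => 1)

lemma prodExpect_mono_of_support (hp : IsKernel p)
    (h : ∀ a, (∀ i, p i (a i) ≠ 0) → F a ≤ G a) : prodExpect p F ≤ prodExpect p G := by
  refine sum_le_sum fun a _ => ?_
  by_cases ha : ∀ i, p i (a i) ≠ 0
  · exact mul_le_mul_of_nonneg_left (h a ha) (prod_nonneg fun i _ => (hp i).1 _)
  · obtain ⟨i, hi⟩ := not_forall_not.1 ha
    rw [prod_eq_zero (mem_univ i) hi, zero_mul, zero_mul]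

lemma prodExpect_mono (hp : IsKernel p) (h : ∀ a, F a ≤ G a) :
    prodExpect p F ≤ prodExpect p G :=
  prodExpect_mono_of_support hp fun a _ => h a

lemma prodExpect_nonneg (hp : IsKernel p) (h : ∀ a, 0 ≤ F a) : 0 ≤ prodExpect p F :=
  (prodExpect_const hp 0).symm.trans_le (prodExpect_mono hp h)

lemma prodExpect_le_of_forall_le (hp : IsKernel p) {c : ℝ} (h : ∀ a, F a ≤ c) :
    prodExpect p F ≤ c :=
  (prodExpect_mono hp h).trans_eq (prodExpect_const hp c)

end Kernel

end ProdExpect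

section CompProd

variable {A B : Type*}

/-- The joint mass function of a pair whose first component has mass function `P` and whose second
component has conditional mass function `K`. -/
def compProd (P : A → ℝ) (K : A → B → ℝ) : A × B → ℝ :=
  fun ab => P ab.1 * K ab.1 ab.2

variable [Fintype A] [Fintype B]

lemma compProd_mem_stdSimplex {P : A → ℝ} {K : A → B → ℝ} (hP : P ∈ stdSimplex ℝ A)
    (hK : IsKernel K) : compProd P K ∈ stdSimplex ℝ (A × B) := by
  refine ⟨fun ab => mul_nonneg (hP.1 _) ((hK _).1 _), ?_⟩
  simp only [compProd, Fintype.sum_prod_type, ← mul_sum, (hK _).2, mul_one, hP.2]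

lemma prodExpect_compProd {ι : Type*} [Fintype ι] [DecidableEq ι] (P : A → ℝ) (K : A → B → ℝ)
    (F : (ι → A) → (ι → B) → ℝ) :
    prodExpect (fun _ => compProd P K) (fun ab => F (Prod.fst ∘ ab) (Prod.snd ∘ ab)) =
      prodExpect (fun _ => P) fun a => prodExpect (fun i => K (a i)) (F a) := by
  simp only [prodExpect, compProd, prod_mul_distrib, mul_sum, ← mul_assoc]
  rw [← Fintype.sum_prod_type']
  exact Fintype.sum_equiv (Equiv.arrowProdEquivProdArrow ι (fun _ => A) (fun _ => B)) _ _
    fun _ => rfl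

end CompProd

/-! ### Large deviations of i.i.d. sequences -/

section LargeDeviations

variable {A B : Type*} [Fintype A] [Fintype B]

/- At `t = 0` the function `t ↦ ∑ a, P a * exp (t * (φ a - c))` has value `1` and negative
derivative. -/
lemma exists_sum_mul_exp_lt_one {P φ : A → ℝ} (hP : ∑ a, P a = 1) {c : ℝ}
    (hc : ∑ a, P a * φ a < c) :
    ∃ t : ℝ, 0 < t ∧ ∑ a, P a * Real.exp (t * (φ a - c)) < 1 := by
  set M : ℝ → ℝ := fun t => ∑ a, P a * Real.exp (t * (φ a - c))
  have hM : HasDerivAt M (∑ a, P a * (φ a - c)) 0 := by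
    refine HasDerivAt.fun_sum fun a _ => ?_
    simpa using ((hasDerivAt_mul_const (φ a - c)).exp).const_mul (P a) (x := (0 : ℝ))
  have hM0 : M 0 = 1 := by simp [M, hP]
  have hneg : ∑ a, P a * (φ a - c) < 0 := by
    simp only [mul_sub, sum_sub_distrib, ← sum_mul, hP]
    linarith
  obtain ⟨t, hslope, ht⟩ :=
    ((hM.tendsto_slope_zero_right.eventually (gt_mem_nhds hneg)).and self_mem_nhdsWithin).exists
  refine ⟨t, ht, ?_⟩
  rw [zero_add, hM0, smul_eq_mul] at hslope
  linarith [(pos_iff_neg_of_mul_neg hslope).1 (inv_pos.2 ht)]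

lemma exists_prodExpect_ind_le_exp {P φ : A → ℝ} (hP : P ∈ stdSimplex ℝ A) {c : ℝ}
    (hc : ∑ a, P a * φ a < c) :
    ∃ r : ℝ, 0 < r ∧ ∀ n : ℕ, prodExpect (fun _ : Fin n => P)
      (fun a => ind (n * c ≤ ∑ i, φ (a i))) ≤ Real.exp (-(r * n)) := by
  obtain ⟨t, ht, hlt⟩ := exists_sum_mul_exp_lt_one hP.2 hc
  set M := ∑ a, P a * Real.exp (t * (φ a - c))
  have hMpos : 0 < M := by
    obtain ⟨a, -, ha⟩ := exists_ne_zero_of_sum_ne_zero (hP.2.trans_ne one_ne_zero)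
    exact sum_pos' (fun a _ => mul_nonneg (hP.1 a) (Real.exp_pos _).le)
      ⟨a, mem_univ a, mul_pos ((hP.1 a).lt_of_ne' ha) (Real.exp_pos _)⟩
  refine ⟨-Real.log M, by linarith [Real.log_neg hMpos hlt], fun n => ?_⟩
  calc prodExpect (fun _ : Fin n => P) (fun a => ind (n * c ≤ ∑ i, φ (a i)))
      ≤ prodExpect (fun _ => P) (fun a => ∏ i, Real.exp (t * (φ (a i) - c))) := by
        refine prodExpect_mono (fun _ => hP) fun a => ?_
        rw [← Real.exp_sum, ← mul_sum, sum_sub_distrib, Fin.sum_const, nsmul_eq_mul]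
        by_cases h : n * c ≤ ∑ i, φ (a i)
        · rw [ind_of_true h]
          exact Real.one_le_exp (mul_nonneg ht.le (sub_nonneg.2 h))
        · rw [ind_of_false h]
          exact (Real.exp_pos _).le
    _ = M ^ n := by
        rw [prodExpect_prod (fun _ => P) fun _ a => Real.exp (t * (φ a - c)), prod_const,
          card_univ, Fintype.card_fin]
    _ = Real.exp (-(-Real.log M * n)) := by
        rw [neg_mul, neg_neg, mul_comm, Real.exp_nat_mul, Real.exp_log hMpos]

lemma exists_prodExpect_ind_prod_lt_le_exp {P g : A → ℝ} (hP : P ∈ stdSimplex ℝ A)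
    (hg : ∀ a, P a ≠ 0 → 0 < g a) {c : ℝ} (hc : ∑ a, P a * -Real.log (g a) < c) :
    ∃ r : ℝ, 0 < r ∧ ∀ n : ℕ, prodExpect (fun _ : Fin n => P)
      (fun a => ind (∏ i, g (a i) < Real.exp (-(n * c)))) ≤ Real.exp (-(r * n)) := by
  obtain ⟨r, hr, h⟩ := exists_prodExpect_ind_le_exp hP hc
  refine ⟨r, hr, fun n => le_trans (prodExpect_mono_of_support (fun _ => hP) fun a ha => ?_) (h n)⟩
  have hpos : ∀ i, 0 < g (a i) := fun i => hg _ (ha i)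
  refine ind_mono fun hlt => ?_
  rw [← Real.log_lt_iff_lt_exp (prod_pos fun i _ => hpos i),
    Real.log_prod fun i _ => (hpos i).ne'] at hlt
  rw [sum_neg_distrib]
  linarith

lemma exists_exp_add_exp_le {N : ℕ → ℕ} {ρ : ℝ} (hρ : 0 < ρ)
    (hN : Tendsto (fun n => (N n : ℝ) / n) atTop (𝓝 ρ)) {r₁ r₂ : ℝ} (hr₁ : 0 < r₁) (hr₂ : 0 < r₂) :
    ∃ r : ℝ, 0 < r ∧ ∀ᶠ n : ℕ in atTop,
      Real.exp (-(r₁ * n)) + Real.exp (-(r₂ * N n)) ≤ Real.exp (-(r * n)) := by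
  obtain ⟨r, hr, h₁, h₂⟩ : ∃ r : ℝ, 0 < r ∧ 2 * r ≤ r₁ ∧ 2 * r ≤ r₂ * (ρ / 2) :=
    ⟨min r₁ (r₂ * (ρ / 2)) / 2, by positivity,
      (mul_div_cancel₀ _ two_ne_zero).trans_le (min_le_left _ _),
      (mul_div_cancel₀ _ two_ne_zero).trans_le (min_le_right _ _)⟩
  have hN_ge : ∀ᶠ n : ℕ in atTop, ρ / 2 < (N n : ℝ) / n :=
    hN.eventually (lt_mem_nhds (half_lt_self hρ))
  have hlarge : ∀ᶠ n : ℕ in atTop, Real.log 2 ≤ r * n :=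
    (tendsto_natCast_atTop_atTop.const_mul_atTop hr).eventually_ge_atTop _
  refine ⟨r, hr, ?_⟩
  filter_upwards [hN_ge, hlarge, eventually_gt_atTop 0] with n hge hn hn0
  rw [lt_div_iff₀ (Nat.cast_pos.2 hn0)] at hge
  have hN_exp : 2 * r * n ≤ r₂ * N n :=
    calc 2 * r * n ≤ r₂ * (ρ / 2) * n := by gcongr
      _ = r₂ * (ρ / 2 * n) := mul_assoc _ _ _
      _ ≤ r₂ * N n := by gcongr
  calc Real.exp (-(r₁ * n)) + Real.exp (-(r₂ * N n))
      ≤ Real.exp (-(2 * r * n)) + Real.exp (-(2 * r * n)) := by gcongr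
    _ = Real.exp (Real.log 2 + -(2 * r * n)) := by
        rw [Real.exp_add, Real.exp_log two_pos, two_mul (Real.exp _)]
    _ ≤ Real.exp (-(r * n)) := Real.exp_le_exp.2 (by linarith)

lemma ind_mul_lt_mul_le {x y s t : ℝ} (hs : 0 < s) (ht : 0 < t) :
    ind (x * y < s * t) ≤ ind (x < s) + ind (y < t) := by
  refine (ind_mono fun h => ?_).trans (ind_or_le _ _)
  by_contra! hcon
  exact absurd h (not_lt.2 (mul_le_mul hcon.1 hcon.2 ht.le (hs.le.trans hcon.1)))

lemma exists_prodExpect_ind_mul_lt_le_exp {P g : A → ℝ} {Q g' : B → ℝ}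
    (hP : P ∈ stdSimplex ℝ A) (hQ : Q ∈ stdSimplex ℝ B)
    (hg : ∀ a, P a ≠ 0 → 0 < g a) (hg' : ∀ b, Q b ≠ 0 → 0 < g' b)
    {N : ℕ → ℕ} {ρ : ℝ} (hρ : 0 < ρ) (hN : Tendsto (fun n => (N n : ℝ) / n) atTop (𝓝 ρ)) {c : ℝ}
    (hc : ∑ a, P a * -Real.log (g a) + ρ * ∑ b, Q b * -Real.log (g' b) < c) :
    ∃ r : ℝ, 0 < r ∧ ∀ᶠ n : ℕ in atTop, prodExpect (fun _ : Fin n => P) (fun a =>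
      prodExpect (fun _ : Fin (N n) => Q) fun b =>
        ind ((∏ i, g (a i)) * ∏ j, g' (b j) < Real.exp (-(n * c)))) ≤ Real.exp (-(r * n)) := by
  set α := ∑ a, P a * -Real.log (g a)
  set β := ∑ b, Q b * -Real.log (g' b)
  obtain ⟨ε, hεc, hε⟩ : ∃ ε : ℝ, (α + ε) + ρ * (β + ε) < c ∧ 0 < ε := by
    have hcont : Continuous fun ε : ℝ => (α + ε) + ρ * (β + ε) := by fun_prop
    have hlim : Tendsto (fun ε : ℝ => (α + ε) + ρ * (β + ε)) (𝓝[>] 0) (𝓝 (α + ρ * β)) := by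
      simpa using (hcont.tendsto 0).mono_left nhdsWithin_le_nhds
    exact ((hlim.eventually (gt_mem_nhds hc)).and self_mem_nhdsWithin).exists
  obtain ⟨r₁, hr₁, h₁⟩ := exists_prodExpect_ind_prod_lt_le_exp hP hg (lt_add_of_pos_right α hε)
  obtain ⟨r₂, hr₂, h₂⟩ := exists_prodExpect_ind_prod_lt_le_exp hQ hg' (lt_add_of_pos_right β hε)
  obtain ⟨r, hr, hexp⟩ := exists_exp_add_exp_le hρ hN hr₁ hr₂
  have hN_lt : ∀ᶠ n : ℕ in atTop, (α + ε) + (N n : ℝ) / n * (β + ε) < c :=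
    ((hN.mul_const (β + ε)).const_add (α + ε)).eventually (gt_mem_nhds hεc)
  refine ⟨r, hr, ?_⟩
  filter_upwards [hexp, hN_lt, eventually_gt_atTop 0] with n hexp hlt hn0
  have hthreshold :
      Real.exp (-(n * c)) ≤ Real.exp (-(n * (α + ε))) * Real.exp (-(N n * (β + ε))) := by
    have hn0' : (0 : ℝ) < n := Nat.cast_pos.2 hn0
    have := mul_lt_mul_of_pos_left hlt hn0'
    rw [mul_add, ← mul_assoc, mul_div_cancel₀ _ hn0'.ne'] at this
    rw [← Real.exp_add, Real.exp_le_exp]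
    linarith
  calc _ ≤ prodExpect (fun _ : Fin n => P) (fun a => prodExpect (fun _ : Fin (N n) => Q) fun b =>
        ind (∏ i, g (a i) < Real.exp (-(n * (α + ε)))) +
          ind (∏ j, g' (b j) < Real.exp (-(N n * (β + ε))))) :=
        prodExpect_mono (fun _ => hP) fun a => prodExpect_mono (fun _ => hQ) fun b =>
          (ind_mono fun h => h.trans_le hthreshold).trans
            (ind_mul_lt_mul_le (Real.exp_pos _) (Real.exp_pos _))
    _ ≤ Real.exp (-(r₁ * n)) + Real.exp (-(r₂ * N n)) := by
        simp only [prodExpect_add, prodExpect_const fun _ : Fin (N n) => hQ,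
          prodExpect_const fun _ : Fin n => hP]
        exact add_le_add (h₁ n) (h₂ (N n))
    _ ≤ Real.exp (-(r * n)) := hexp

lemma exists_prodExpect_ind_lt_mul_le_exp {P g : A → ℝ} {Q g' : B → ℝ}
    (hP : P ∈ stdSimplex ℝ A) (hQ : Q ∈ stdSimplex ℝ B)
    (hg : ∀ a, P a ≠ 0 → 0 < g a) (hg' : ∀ b, Q b ≠ 0 → 0 < g' b)
    {N : ℕ → ℕ} {ρ : ℝ} (hρ : 0 < ρ) (hN : Tendsto (fun n => (N n : ℝ) / n) atTop (𝓝 ρ)) {c : ℝ}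
    (hc : c < ∑ a, P a * -Real.log (g a) + ρ * ∑ b, Q b * -Real.log (g' b)) :
    ∃ r : ℝ, 0 < r ∧ ∀ᶠ n : ℕ in atTop, prodExpect (fun _ : Fin n => P) (fun a =>
      prodExpect (fun _ : Fin (N n) => Q) fun b =>
        ind (Real.exp (-(n * c)) < (∏ i, g (a i)) * ∏ j, g' (b j))) ≤ Real.exp (-(r * n)) := by
  obtain ⟨r, hr, h⟩ := exists_prodExpect_ind_mul_lt_le_exp hP hQ (g := fun a => (g a)⁻¹)
    (g' := fun b => (g' b)⁻¹) (fun a ha => inv_pos.2 (hg a ha)) (fun b hb => inv_pos.2 (hg' b hb))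
    hρ hN (c := -c)
    (by simp only [Real.log_inv, mul_neg, sum_neg_distrib, neg_neg] at hc ⊢; linarith)
  refine ⟨r, hr, h.mono fun n hn => le_trans ?_ hn⟩
  refine prodExpect_mono (fun _ => hP) fun a => prodExpect_mono (fun _ => hQ) fun b =>
    ind_mono fun h => ?_
  rw [prod_inv_distrib, prod_inv_distrib, ← mul_inv, mul_neg, Real.exp_neg (-(n * c))]
  exact inv_strictAnti₀ (Real.exp_pos _) h

end LargeDeviations

/-! ### Weights and concatenation -/

/-- The mass function of a bit of bias `q`, that is, of a bit which is `1` with probability `q`. -/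
noncomputable def bitMass (q : ℝ) (b : ZMod 2) : ℝ := if b = 1 then q else 1 - q

lemma bitMass_one (q : ℝ) : bitMass q 1 = q := if_pos rfl

lemma bitMass_zero (q : ℝ) : bitMass q 0 = 1 - q := if_neg (by decide)

lemma sum_zmod_two {M : Type*} [AddCommMonoid M] (g : ZMod 2 → M) : ∑ b, g b = g 0 + g 1 :=
  Fin.sum_univ_two g

lemma sum_bitMass (q : ℝ) : ∑ b, bitMass q b = 1 := by
  rw [sum_zmod_two, bitMass_zero, bitMass_one, sub_add_cancel]

lemma bitMass_nonneg {q : ℝ} (hq : q ∈ Set.Icc (0 : ℝ) 1) (b : ZMod 2) : 0 ≤ bitMass q b := by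
  unfold bitMass
  split_ifs
  exacts [hq.1, sub_nonneg.2 hq.2]

lemma bitMass_mem_stdSimplex {q : ℝ} (hq : q ∈ Set.Icc (0 : ℝ) 1) :
    bitMass q ∈ stdSimplex ℝ (ZMod 2) :=
  ⟨bitMass_nonneg hq, sum_bitMass q⟩

section Weight

variable {n : ℕ} {q : Fin n → ℝ}

lemma prodExpect_bitMass (q : Fin n → ℝ) (F : (Fin n → ZMod 2) → ℝ) :
    prodExpect (fun i => bitMass (q i)) F = ∑ u, weight q u * F u :=
  rfl

lemma weight_nonneg (hq : ∀ i, q i ∈ Set.Icc (0 : ℝ) 1) (u : Fin n → ZMod 2) : 0 ≤ weight q u :=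
  prod_nonneg fun i _ => bitMass_nonneg (hq i) (u i)

lemma sum_weight (hq : ∀ i, q i ∈ Set.Icc (0 : ℝ) 1) : ∑ u, weight q u = 1 := by
  simpa only [prodExpect_bitMass, mul_one] using
    prodExpect_const (fun i => bitMass_mem_stdSimplex (hq i)) 1

lemma weight_le_one (hq : ∀ i, q i ∈ Set.Icc (0 : ℝ) 1) (u : Fin n → ZMod 2) : weight q u ≤ 1 :=
  (single_le_sum (fun v _ => weight_nonneg hq v) (mem_univ u)).trans_eq (sum_weight hq)

lemma weight_bits (m u : Fin n → ZMod 2) :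
    weight (fun j => if m j = 1 then 1 else 0) u = ind (u = m) := by
  have bit (a b : ZMod 2) : (if a = 1 then if b = 1 then (1 : ℝ) else 0
      else 1 - if b = 1 then (1 : ℝ) else 0) = if a = b then 1 else 0 := by
    have zero_or_one : ∀ c : ZMod 2, c = 0 ∨ c = 1 := by decide
    obtain rfl | rfl := zero_or_one a <;> obtain rfl | rfl := zero_or_one b <;> simp
  simp only [weight, bit, prod_ite_zero, prod_const_one, mem_univ, true_imp_iff, ind_eq_ite,
    funext_iff]

lemma weight_half (u : Fin n → ZMod 2) : weight (fun _ => 1 / 2) u = (1 / 2) ^ n := by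
  simp only [weight, sub_half, ite_self, prod_const, card_univ, Fintype.card_fin]

end Weight

section Split

variable {n k : ℕ} {B : Type*}

/-- The positions `0, …, k - 1` and `k, …, n - 1` of a sequence of length `n`. -/
def splitFin (h : k ≤ n) : Fin k ⊕ Fin (n - k) ≃ Fin n :=
  finSumFinEquiv.trans (finCongr (Nat.add_sub_of_le h))

/-- The first `k` letters. -/
def headVec (h : k ≤ n) (z : Fin n → B) : Fin k → B := fun j => z (splitFin h (Sum.inl j))

/-- The last `n - k` letters. -/
def tailVec (h : k ≤ n) (z : Fin n → B) : Fin (n - k) → B := fun j => z (splitFin h (Sum.inr j))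

/-- A sequence as the pair of its first `k` and its last `n - k` letters. -/
def splitVec (h : k ≤ n) : (Fin n → B) ≃ (Fin k → B) × (Fin (n - k) → B) :=
  ((splitFin h).symm.arrowCongr (Equiv.refl B)).trans (Equiv.sumArrowEquivProdArrow _ _ _)

lemma exists_headVec_tailVec (h : k ≤ n) (m : Fin k → B) (v : Fin (n - k) → B) :
    ∃ z : Fin n → B, headVec h z = m ∧ tailVec h z = v :=
  ⟨(splitVec h).symm (m, v), Prod.ext_iff.1 ((splitVec h).apply_symm_apply (m, v))⟩

lemma sum_headVec_tailVec [Fintype B] (h : k ≤ n) (F : (Fin k → B) → (Fin (n - k) → B) → ℝ) :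
    ∑ z : Fin n → B, F (headVec h z) (tailVec h z) = ∑ m, ∑ v, F m v := by
  rw [← Fintype.sum_prod_type' F]
  exact (splitVec h).sum_comp fun mv => F mv.1 mv.2

lemma sum_ind_headVec_mul [Fintype B] (h : k ≤ n) (m : Fin k → B) (F : (Fin (n - k) → B) → ℝ) :
    ∑ z : Fin n → B, ind (headVec h z = m) * F (tailVec h z) = ∑ v, F v := by
  classical
  rw [sum_headVec_tailVec h fun a v => ind (a = m) * F v]
  simp only [← mul_sum]
  simp only [ind_eq_ite, ite_mul, one_mul, zero_mul, sum_ite_eq', mem_univ, if_true]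

lemma weight_concat (h : k ≤ n) (a : Fin k → ℝ) (b : Fin (n - k) → ℝ) (z : Fin n → ZMod 2) :
    weight (concat a b) z = weight a (headVec h z) * weight b (tailVec h z) := by
  have hhead (j : Fin k) : concat a b (splitFin h (Sum.inl j)) = a j := by
    simp [concat, splitFin]
  have htail (j : Fin (n - k)) : concat a b (splitFin h (Sum.inr j)) = b j := by
    simp [concat, splitFin]
  rw [weight, ← (splitFin h).prod_comp, Fintype.prod_sum_type]
  simp only [hhead, htail]
  rfl

end Split

/-! ### Random biases -/

/-- A distribution on a finite type of letters, each of which carries the bias of a bit: the states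
with the codeword biases `p_e` of the encoder, or the values of the parity bias `Q`. -/
structure RandomBias (S : Type*) [Fintype S] where
  mass : S → ℝ
  bias : S → ℝ
  mass_mem : mass ∈ stdSimplex ℝ S
  bias_mem : ∀ s, bias s ∈ Set.Icc (0 : ℝ) 1

namespace RandomBias

variable {S : Type*} [Fintype S] (σ : RandomBias S) {n : ℕ}

lemma weight_bias_nonneg (s : Fin n → S) (x : Fin n → ZMod 2) : 0 ≤ weight (σ.bias ∘ s) x :=
  weight_nonneg (fun _ => σ.bias_mem _) x

lemma sum_weight_bias (s : Fin n → S) : ∑ x, weight (σ.bias ∘ s) x = 1 :=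
  sum_weight fun _ => σ.bias_mem _

/-- The joint mass function of a random letter and a bit with the bias of that letter. -/
noncomputable def joint : S × ZMod 2 → ℝ := compProd σ.mass fun s => bitMass (σ.bias s)

lemma isKernel_mass : IsKernel fun _ : Fin n => σ.mass := fun _ => σ.mass_mem

lemma isKernel_bitMass : IsKernel fun s => bitMass (σ.bias s) :=
  fun s => bitMass_mem_stdSimplex (σ.bias_mem s)

lemma joint_mem_stdSimplex : σ.joint ∈ stdSimplex ℝ (S × ZMod 2) :=
  compProd_mem_stdSimplex σ.mass_mem σ.isKernel_bitMass

lemma prodExpect_joint (F : (Fin n → S) → (Fin n → ZMod 2) → ℝ) :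
    prodExpect (fun _ => σ.joint) (fun c => F (Prod.fst ∘ c) (Prod.snd ∘ c)) =
      prodExpect (fun _ => σ.mass) fun s => ∑ x, weight (σ.bias ∘ s) x * F s x :=
  prodExpect_compProd _ _ _

lemma prodExpect_weight_zero :
    prodExpect (fun _ : Fin n => σ.mass) (fun s => weight (σ.bias ∘ s) 0) =
      (∑ s, σ.mass s * (1 - σ.bias s)) ^ n := by
  have h := prodExpect_prod (fun _ : Fin n => σ.mass) fun _ s => bitMass (σ.bias s) 0
  simp only [bitMass_zero, prod_const, card_univ, Fintype.card_fin] at h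
  simpa only [weight, Function.comp_apply, Pi.zero_apply, zero_ne_one, if_false] using h

end RandomBias

/-! ### Encoder and decoder weights -/

section CodeWeights

variable {n k : ℕ} (h : k ≤ n)

/-- The weight `w_p(x) w_{[m,q]}(x Hᵀ)` maximized by the encoder. -/
noncomputable def encWeight (p : Fin n → ℝ) (m : Fin k → ZMod 2) (q : Fin (n - k) → ℝ)
    (H : GL (Fin n) (ZMod 2)) (x : Fin n → ZMod 2) : ℝ :=
  weight p x * (ind (headVec h (parity H x) = m) * weight q (tailVec h (parity H x)))

/-- `2ᵏ` times the weight `w_p(x) w_{[1/2,…,1/2,q]}(x Hᵀ)` maximized by the decoder. -/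
noncomputable def decWeight (p : Fin n → ℝ) (q : Fin (n - k) → ℝ) (H : GL (Fin n) (ZMod 2))
    (x : Fin n → ZMod 2) : ℝ :=
  weight p x * weight q (tailVec h (parity H x))

variable {p : Fin n → ℝ} {q : Fin (n - k) → ℝ}

lemma encWeight_nonneg (hp : ∀ i, p i ∈ Set.Icc (0 : ℝ) 1) (m : Fin k → ZMod 2)
    (hq : ∀ i, q i ∈ Set.Icc (0 : ℝ) 1) (H : GL (Fin n) (ZMod 2)) (x : Fin n → ZMod 2) :
    0 ≤ encWeight h p m q H x :=
  mul_nonneg (weight_nonneg hp x) (mul_nonneg (ind_nonneg _) (weight_nonneg hq _))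

lemma decWeight_nonneg (hp : ∀ i, p i ∈ Set.Icc (0 : ℝ) 1) (hq : ∀ i, q i ∈ Set.Icc (0 : ℝ) 1)
    (H : GL (Fin n) (ZMod 2)) (x : Fin n → ZMod 2) : 0 ≤ decWeight h p q H x :=
  mul_nonneg (weight_nonneg hp x) (weight_nonneg hq _)

lemma decWeight_zero_le (hp : ∀ i, p i ∈ Set.Icc (0 : ℝ) 1) (hq : ∀ i, q i ∈ Set.Icc (0 : ℝ) 1)
    (H : GL (Fin n) (ZMod 2)) : decWeight h p q H 0 ≤ weight q 0 := by
  rw [decWeight, parity_zero]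
  exact mul_le_of_le_one_left (weight_nonneg hq _) (weight_le_one hp _)

lemma encWeight_le_encWeight_encode {S : Type*} {f : Query} (hf : IsQuery f) (pe : S → ℝ)
    (H : GL (Fin n) (ZMod 2)) (q : Fin (n - k) → ℝ) (m : Fin k → ZMod 2) (s : Fin n → S)
    (x : Fin n → ZMod 2) :
    encWeight h (pe ∘ s) m q H x ≤ encWeight h (pe ∘ s) m q H (encode f pe H q m s) := by
  have hmax := hf n H (pe ∘ s) (concat (fun j => if m j = 1 then 1 else 0) q) x
  rwa [weight_concat h, weight_concat h, weight_bits, weight_bits] at hmax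

lemma exists_decode_eq_headVec {Y : Type*} {f : Query} (hf : IsQuery f) (pd : Y → ℝ)
    (H : GL (Fin n) (ZMod 2)) (q : Fin (n - k) → ℝ) (y : Fin n → Y) :
    ∃ x, decode f pd H q y = headVec h (parity H x) ∧
      ∀ x', decWeight h (pd ∘ y) q H x' ≤ decWeight h (pd ∘ y) q H x := by
  refine ⟨f n H (pd ∘ y) (concat (fun _ : Fin k => 1 / 2) q), ?_, fun x' => ?_⟩
  · ext j
    exact dif_pos (j.2.trans_le h)
  · have hmax := hf n H (pd ∘ y) (concat (fun _ : Fin k => 1 / 2) q) x'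
    rw [weight_concat h, weight_concat h, weight_half, weight_half, mul_left_comm,
      mul_left_comm (weight (pd ∘ y) _)] at hmax
    exact le_of_mul_le_mul_left hmax (by positivity)

lemma expect_ind_headVec_mul_le (hn : 2 ≤ n) {x : Fin n → ZMod 2} (hx : x ≠ 0) (m : Fin k → ZMod 2)
    {F : (Fin (n - k) → ZMod 2) → ℝ} (hF : ∀ v, 0 ≤ F v) :
    𝔼 H : GL (Fin n) (ZMod 2), ind (headVec h (parity H x) = m) * F (tailVec h (parity H x)) ≤
      (∑ v, F v) / (2 ^ n - 1) := by
  rw [← sum_ind_headVec_mul h m F]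
  exact expect_parity_le hn hx (F := fun z => ind (headVec h z = m) * F (tailVec h z))
    fun _ => mul_nonneg (ind_nonneg _) (hF _)

lemma expect_ind_headVec_mul_mul_le (hn : 2 ≤ n) {x x' : Fin n → ZMod 2} (hx : x ≠ 0)
    (hx' : x' ≠ 0) (hxx' : x ≠ x') (m : Fin k → ZMod 2) {F G : (Fin (n - k) → ZMod 2) → ℝ}
    (hF : ∀ v, 0 ≤ F v) (hG : ∀ v, 0 ≤ G v) :
    𝔼 H : GL (Fin n) (ZMod 2), ind (headVec h (parity H x) = m) * F (tailVec h (parity H x)) *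
        G (tailVec h (parity H x')) ≤
      2 ^ k * (∑ v, F v) * (∑ v, G v) / ((2 ^ n - 1) * (2 ^ n - 2)) := by
  have hsum : ∑ z : Fin n → ZMod 2, G (tailVec h z) = 2 ^ k * ∑ v, G v := by
    simp [sum_headVec_tailVec h fun _ v => G v]
  have := expect_parity_mul_parity_le hn hx hx' hxx'
    (F := fun z => ind (headVec h z = m) * F (tailVec h z)) (G := fun z => G (tailVec h z))
    (fun _ => mul_nonneg (ind_nonneg _) (hF _)) fun _ => hG _
  rw [sum_ind_headVec_mul, hsum] at this
  exact this.trans_eq (by ring)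

end CodeWeights

/-! ### The law of the codeword -/

section CodewordLaw

variable {S T Y : Type*} [Fintype S] [Fintype T] [Fintype Y] {n k : ℕ} (h : k ≤ n)
  (σ : RandomBias S) (κ : RandomBias T) (W : S → ZMod 2 → Y → ℝ) (m : Fin k → ZMod 2)

/-- The probability of `E H q s x y` when the message `m` is sent: `s` is the state sequence, `q`
the sequence of parity letters, `x` the codeword and `y` the channel output. -/
noncomputable def msgProb (f : Query)
    (E : GL (Fin n) (ZMod 2) → (Fin (n - k) → T) → (Fin n → S) → (Fin n → ZMod 2) → (Fin n → Y) →
      Prop) : ℝ :=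
  prodExpect (fun _ => σ.mass) fun s => prodExpect (fun _ => κ.mass) fun q =>
    𝔼 H, prodExpect (fun i => W (s i) (encode f σ.bias H (κ.bias ∘ q) m s i)) fun y =>
      ind (E H q s (encode f σ.bias H (κ.bias ∘ q) m s) y)

/-- The probability that no word has encoder weight at least `θ`. -/
noncomputable def failProb (θ : ℝ) : ℝ :=
  prodExpect (fun _ => σ.mass) fun s => prodExpect (fun _ => κ.mass) fun q =>
    𝔼 H, ind (∀ x, encWeight h (σ.bias ∘ s) m (κ.bias ∘ q) H x < θ)

/-- The expectation of the sum of `F H q s x y` over all words `x`, each counted with its encoder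
weight, where `y` is the channel output for the input `x`. -/
noncomputable def weightedExpect
    (F : GL (Fin n) (ZMod 2) → (Fin (n - k) → T) → (Fin n → S) → (Fin n → ZMod 2) → (Fin n → Y) →
      ℝ) : ℝ :=
  prodExpect (fun _ => σ.mass) fun s => ∑ x, weight (σ.bias ∘ s) x *
    prodExpect (fun i => W (s i) (x i)) fun y => prodExpect (fun _ => κ.mass) fun q =>
      𝔼 H, ind (headVec h (parity H x) = m) *
        (weight (κ.bias ∘ q) (tailVec h (parity H x)) * F H q s x y)

/-- The expectation of `F q v s x y` under the ideal law of the code: the pairs `(s i, x i)` are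
i.i.d. with law `σ.joint`, `y` is the channel output, and the pairs `(q j, v j)` of parity letters
and parity bits are i.i.d. with law `κ.joint`. -/
noncomputable def idealExpect {N : ℕ}
    (F : (Fin N → T) → (Fin N → ZMod 2) → (Fin n → S) → (Fin n → ZMod 2) → (Fin n → Y) → ℝ) : ℝ :=
  prodExpect (fun _ => σ.mass) fun s => ∑ x, weight (σ.bias ∘ s) x *
    prodExpect (fun i => W (s i) (x i)) fun y => prodExpect (fun _ => κ.mass) fun q =>
      ∑ v, weight (κ.bias ∘ q) v * F q v s x y

variable {σ κ W m}

lemma weightedExpect_eq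
    (F : GL (Fin n) (ZMod 2) → (Fin (n - k) → T) → (Fin n → S) → (Fin n → ZMod 2) → (Fin n → Y) →
      ℝ) :
    weightedExpect h σ κ W m F =
      prodExpect (fun _ => σ.mass) fun s => prodExpect (fun _ => κ.mass) fun q => 𝔼 H, ∑ x,
        encWeight h (σ.bias ∘ s) m (κ.bias ∘ q) H x *
          prodExpect (fun i => W (s i) (x i)) (F H q s x) := by
  simp only [weightedExpect, encWeight, mul_assoc, expect_sum_comm, ← mul_expect, prodExpect_sum,
    prodExpect_mul_left]
  simp only [← prodExpect_mul_left, ← prodExpect_expect]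
  simp only [prodExpect_comm (fun _ : Fin (n - k) => κ.mass)]

lemma weightedExpect_add
    (F G : GL (Fin n) (ZMod 2) → (Fin (n - k) → T) → (Fin n → S) → (Fin n → ZMod 2) →
      (Fin n → Y) → ℝ) :
    weightedExpect h σ κ W m (fun H q s x y => F H q s x y + G H q s x y) =
      weightedExpect h σ κ W m F + weightedExpect h σ κ W m G := by
  simp only [weightedExpect, mul_add, expect_add_distrib, prodExpect_add, sum_add_distrib]

omit [Fintype S] in
lemma IsStateChannel.isKernel (hW : IsStateChannel W) (s : Fin n → S) (x : Fin n → ZMod 2) :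
    IsKernel fun i => W (s i) (x i) :=
  fun i => hW (s i) (x i)

lemma weightedExpect_div
    (F : GL (Fin n) (ZMod 2) → (Fin (n - k) → T) → (Fin n → S) → (Fin n → ZMod 2) → (Fin n → Y) →
      ℝ) (c : ℝ) :
    weightedExpect h σ κ W m (fun H q s x y => F H q s x y / c) =
      weightedExpect h σ κ W m F / c := by
  simp only [weightedExpect, div_eq_mul_inv, ← mul_assoc, ← expect_mul, prodExpect_mul_right,
    ← sum_mul]

lemma weightedExpect_mono (hW : IsStateChannel W)
    {F G : GL (Fin n) (ZMod 2) → (Fin (n - k) → T) → (Fin n → S) → (Fin n → ZMod 2) →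
      (Fin n → Y) → ℝ}
    (hFG : ∀ H q s x y, headVec h (parity H x) = m → F H q s x y ≤ G H q s x y) :
    weightedExpect h σ κ W m F ≤ weightedExpect h σ κ W m G := by
  refine prodExpect_mono σ.isKernel_mass fun s => sum_le_sum fun x _ =>
    mul_le_mul_of_nonneg_left (prodExpect_mono (hW.isKernel s x) fun y =>
      prodExpect_mono κ.isKernel_mass fun q => expect_le_expect fun H _ => ?_)
      (σ.weight_bias_nonneg s x)
  by_cases hx : headVec h (parity H x) = m
  · exact mul_le_mul_of_nonneg_left (mul_le_mul_of_nonneg_left (hFG H q s x y hx)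
      (κ.weight_bias_nonneg q _)) (ind_nonneg _)
  · simp only [ind_of_false hx, zero_mul, le_refl]

lemma weightedExpect_le_idealExpect_div (hW : IsStateChannel W) (hn : 2 ≤ n) (hm : m ≠ 0)
    {F : (Fin (n - k) → T) → (Fin (n - k) → ZMod 2) → (Fin n → S) → (Fin n → ZMod 2) →
      (Fin n → Y) → ℝ} (hF : ∀ q v s x y, 0 ≤ F q v s x y) :
    weightedExpect h σ κ W m (fun H q s x y => F q (tailVec h (parity H x)) s x y) ≤
      idealExpect σ κ W F / (2 ^ n - 1) := by
  have hpos : (0 : ℝ) < 2 ^ n - 1 := by linarith [four_le_two_pow hn]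
  simp only [idealExpect, div_eq_mul_inv, ← prodExpect_mul_right, sum_mul, mul_assoc (weight _ _)]
  refine prodExpect_mono σ.isKernel_mass fun s => sum_le_sum fun x _ =>
    mul_le_mul_of_nonneg_left (prodExpect_mono (hW.isKernel s x) fun y =>
      prodExpect_mono κ.isKernel_mass fun q => ?_) (σ.weight_bias_nonneg s x)
  have hnonneg (v) : 0 ≤ weight (κ.bias ∘ q) v * F q v s x y :=
    mul_nonneg (κ.weight_bias_nonneg q v) (hF q v s x y)
  simp only [← mul_assoc (weight _ _), ← sum_mul]
  obtain rfl | hx := eq_or_ne x 0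
  · have hhead (H : GL (Fin n) (ZMod 2)) : headVec h (parity H 0) ≠ m := by
      rwa [parity_zero, ne_comm]
    simp only [ind_of_false (hhead _), zero_mul, expect_const_zero]
    exact mul_nonneg (sum_nonneg fun v _ => hnonneg v) (inv_nonneg.2 hpos.le)
  · rw [← div_eq_mul_inv]
    exact expect_ind_headVec_mul_le h hn hx m hnonneg

lemma idealExpect_eq_prodExpect {N : ℕ}
    (F : (Fin N → T) → (Fin N → ZMod 2) → (Fin n → S) → (Fin n → ZMod 2) → (Fin n → Y) → ℝ) :
    idealExpect σ κ W F = prodExpect (fun _ => compProd σ.joint fun sx => W sx.1 sx.2) fun a =>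
      prodExpect (fun _ => κ.joint) fun b => F (Prod.fst ∘ b) (Prod.snd ∘ b)
        (Prod.fst ∘ Prod.fst ∘ a) (Prod.snd ∘ Prod.fst ∘ a) (Prod.snd ∘ a) := by
  rw [prodExpect_compProd σ.joint (fun sx => W sx.1 sx.2) fun c y =>
    prodExpect (fun _ => κ.joint) fun b => F (Prod.fst ∘ b) (Prod.snd ∘ b)
      (Prod.fst ∘ c) (Prod.snd ∘ c) y]
  have hκ (s x y) := κ.prodExpect_joint fun q v => F q v s x y
  simp only [hκ]
  exact (σ.prodExpect_joint fun s x => prodExpect (fun i => W (s i) (x i)) fun y =>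
    prodExpect (fun _ => κ.mass) fun q => ∑ v, weight (κ.bias ∘ q) v * F q v s x y).symm

end CodewordLaw

/-! ### Change of measure -/

/-- A maximizer of `w` either has weight below `θ`, and then all weights are below `θ`, or it is
one of the words counted by the weighted sum. -/
lemma le_ind_add_sum_mul_div {ι : Type*} [Fintype ι] {w G : ι → ℝ} {c : ι} (hw : ∀ x, 0 ≤ w x)
    (hmax : ∀ x, w x ≤ w c) (hG : ∀ x, 0 ≤ G x) (hGc : G c ≤ 1) {θ : ℝ} (hθ : 0 < θ) :
    G c ≤ ind (∀ x, w x < θ) + (∑ x, w x * G x) / θ := by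
  have hterm (x : ι) : 0 ≤ w x * G x := mul_nonneg (hw x) (hG x)
  rcases lt_or_ge (w c) θ with hlt | hge
  · rw [ind_of_true fun x => (hmax x).trans_lt hlt]
    exact hGc.trans (le_add_of_nonneg_right (div_nonneg (sum_nonneg fun x _ => hterm x) hθ.le))
  · refine le_add_of_nonneg_of_le (ind_nonneg _) ((le_div_iff₀ hθ).2 ?_)
    calc G c * θ ≤ w c * G c := by rw [mul_comm]; exact mul_le_mul_of_nonneg_right hge (hG c)
      _ ≤ ∑ x, w x * G x := single_le_sum (fun x _ => hterm x) (mem_univ c)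

section ChangeOfMeasure

variable {S T Y : Type*} [Fintype S] [Fintype T] [Fintype Y] {n k : ℕ} (h : k ≤ n)
  {σ : RandomBias S} {κ : RandomBias T} {W : S → ZMod 2 → Y → ℝ} {m : Fin k → ZMod 2} {f : Query}
  {θ : ℝ}

lemma msgProb_le_failProb_add_weightedExpect (hf : IsQuery f) (hW : IsStateChannel W) (hθ : 0 < θ)
    (E : GL (Fin n) (ZMod 2) → (Fin (n - k) → T) → (Fin n → S) → (Fin n → ZMod 2) → (Fin n → Y) →
      Prop) :
    msgProb σ κ W m f E ≤ failProb h σ κ m θ +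
      weightedExpect h σ κ W m (fun H q s x y => ind (E H q s x y)) / θ := by
  rw [weightedExpect_eq, div_eq_mul_inv]
  simp only [msgProb, failProb, ← prodExpect_mul_right, expect_mul, ← prodExpect_add,
    ← expect_add_distrib]
  simp only [← div_eq_mul_inv]
  refine prodExpect_mono σ.isKernel_mass fun s => prodExpect_mono κ.isKernel_mass fun q =>
    expect_le_expect fun H _ => ?_
  exact le_ind_add_sum_mul_div
    (G := fun x => prodExpect (fun i => W (s i) (x i)) fun y => ind (E H q s x y))
    (fun x => encWeight_nonneg h (fun _ => σ.bias_mem _) m (fun _ => κ.bias_mem _) H x)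
    (fun x => encWeight_le_encWeight_encode h hf σ.bias H (κ.bias ∘ q) m s x)
    (fun x => prodExpect_nonneg (hW.isKernel s x) fun _ => ind_nonneg _)
    (prodExpect_le_of_forall_le (hW.isKernel s (encode f σ.bias H (κ.bias ∘ q) m s)) fun _ =>
      ind_le_one _) hθ

lemma msgProb_le_failProb_add_idealExpect (hf : IsQuery f) (hW : IsStateChannel W) (hθ : 0 < θ)
    (hn : 2 ≤ n) (hm : m ≠ 0) (E : (Fin n → S) → (Fin n → ZMod 2) → Prop) :
    msgProb σ κ W m f (fun _ _ s x _ => E s x) ≤ failProb h σ κ m θ +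
      prodExpect (fun _ => σ.joint) (fun c => ind (E (Prod.fst ∘ c) (Prod.snd ∘ c))) /
        ((2 ^ n - 1) * θ) := by
  refine (msgProb_le_failProb_add_weightedExpect h hf hW hθ _).trans ?_
  rw [← div_div]
  gcongr
  refine (weightedExpect_le_idealExpect_div h hW hn hm
    (F := fun _ _ s x _ => ind (E s x)) fun _ _ _ _ _ => ind_nonneg _).trans_eq ?_
  rw [idealExpect, σ.prodExpect_joint fun s x => ind (E s x)]
  simp only [← sum_mul, κ.sum_weight_bias, one_mul,
    prodExpect_const κ.isKernel_mass, prodExpect_const (hW.isKernel _ _)]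

end ChangeOfMeasure

/-! ### Decoding errors -/

section Decoding

variable {S T Y : Type*} [Fintype S] [Fintype T] [Fintype Y] {n k : ℕ} (h : k ≤ n)
  {σ : RandomBias S} {κ : RandomBias T} {W : S → ZMod 2 → Y → ℝ} {m : Fin k → ZMod 2} {f : Query}
  {pd : Y → ℝ} {θ τ : ℝ}

omit [Fintype Y] in
lemma ind_ne_decode_le (hf : IsQuery f) (hpd : ∀ y, pd y ∈ Set.Icc (0 : ℝ) 1)
    {q : Fin (n - k) → ℝ} (hq : ∀ j, q j ∈ Set.Icc (0 : ℝ) 1) (hτ : 0 < τ)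
    {H : GL (Fin n) (ZMod 2)} {x : Fin n → ZMod 2} (hx : headVec h (parity H x) = m)
    (y : Fin n → Y) :
    ind (m ≠ decode f pd H q y) ≤ ind (decWeight h (pd ∘ y) q H x < τ) + ind (τ ≤ weight q 0) +
      (∑ x' with x' ≠ 0 ∧ x' ≠ x, decWeight h (pd ∘ y) q H x') / τ := by
  have hdec (x' : Fin n → ZMod 2) : 0 ≤ decWeight h (pd ∘ y) q H x' :=
    decWeight_nonneg h (fun _ => hpd _) hq H x'
  have hsum : 0 ≤ (∑ x' with x' ≠ 0 ∧ x' ≠ x, decWeight h (pd ∘ y) q H x') / τ :=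
    div_nonneg (sum_nonneg fun x' _ => hdec x') hτ.le
  have h₁ := ind_nonneg (decWeight h (pd ∘ y) q H x < τ)
  have h₂ := ind_nonneg (τ ≤ weight q 0)
  by_cases herr : m ≠ decode f pd H q y
  swap
  · rw [ind_of_false herr]; positivity
  rw [ind_of_true herr]
  rcases lt_or_ge (decWeight h (pd ∘ y) q H x) τ with hlt | hge
  · rw [ind_of_true hlt]; linarith
  obtain ⟨x', hx', hmax⟩ := exists_decode_eq_headVec h hf pd H q y
  have hge' : τ ≤ decWeight h (pd ∘ y) q H x' := hge.trans (hmax x)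
  obtain rfl | hne := eq_or_ne x' 0
  · rw [ind_of_true (hge'.trans (decWeight_zero_le h (fun _ => hpd _) hq H))]; linarith
  have hxx' : x' ≠ x := by
    rintro rfl
    exact herr (hx'.trans hx).symm
  have hone : 1 ≤ (∑ x' with x' ≠ 0 ∧ x' ≠ x, decWeight h (pd ∘ y) q H x') / τ :=
    (one_le_div hτ).2 <| hge'.trans <|
      single_le_sum (fun x'' _ => hdec x'') (mem_filter.2 ⟨mem_univ x', hne, hxx'⟩)
  linarith

omit [Fintype Y] in
lemma expect_ind_headVec_mul_weight_mul_decWeight_le (hn : 2 ≤ n) (hm : m ≠ 0)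
    (hpd : ∀ y, pd y ∈ Set.Icc (0 : ℝ) 1) {q : Fin (n - k) → ℝ}
    (hq : ∀ j, q j ∈ Set.Icc (0 : ℝ) 1) (x : Fin n → ZMod 2) (y : Fin n → Y) :
    𝔼 H, ind (headVec h (parity H x) = m) * (weight q (tailVec h (parity H x)) *
        ∑ x' with x' ≠ 0 ∧ x' ≠ x, decWeight h (pd ∘ y) q H x') ≤
      2 ^ k / ((2 ^ n - 1) * (2 ^ n - 2)) := by
  have h₁ : (0 : ℝ) < 2 ^ n - 1 := by linarith [four_le_two_pow hn]
  have h₂ : (0 : ℝ) < 2 ^ n - 2 := by linarith [four_le_two_pow hn]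
  have hwt (x') : 0 ≤ weight (pd ∘ y) x' := weight_nonneg (fun _ => hpd _) x'
  obtain rfl | hx := eq_or_ne x 0
  · have hhead (H : GL (Fin n) (ZMod 2)) : headVec h (parity H 0) ≠ m := by
      rwa [parity_zero, ne_comm]
    simp only [ind_of_false (hhead _), zero_mul, expect_const_zero]
    positivity
  calc _ = ∑ x' with x' ≠ 0 ∧ x' ≠ x, weight (pd ∘ y) x' *
        𝔼 H, ind (headVec h (parity H x) = m) * weight q (tailVec h (parity H x)) *
          weight q (tailVec h (parity H x')) := by
        simp only [mul_expect, mul_sum, expect_sum_comm, decWeight]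
        exact sum_congr rfl fun x' _ => expect_congr rfl fun H _ => by ring
    _ ≤ ∑ x' with x' ≠ 0 ∧ x' ≠ x, weight (pd ∘ y) x' * (2 ^ k / ((2 ^ n - 1) * (2 ^ n - 2))) := by
        refine sum_le_sum fun x' hx' => mul_le_mul_of_nonneg_left ?_ (hwt x')
        obtain ⟨hx'0, hx'x⟩ := (mem_filter.1 hx').2
        simpa only [sum_weight hq, mul_one] using expect_ind_headVec_mul_mul_le h hn hx hx'0
          hx'x.symm m (weight_nonneg hq) (weight_nonneg hq)
    _ ≤ ∑ x', weight (pd ∘ y) x' * (2 ^ k / ((2 ^ n - 1) * (2 ^ n - 2))) :=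
        sum_le_univ_sum_of_nonneg fun x' => mul_nonneg (hwt x') (by positivity)
    _ = _ := by rw [← sum_mul, sum_weight (q := pd ∘ y) fun _ => hpd _, one_mul]

lemma weightedExpect_sum_decWeight_le (hW : IsStateChannel W) (hn : 2 ≤ n) (hm : m ≠ 0)
    (hpd : ∀ y, pd y ∈ Set.Icc (0 : ℝ) 1) :
    weightedExpect h σ κ W m (fun H q _ x y =>
        ∑ x' with x' ≠ 0 ∧ x' ≠ x, decWeight h (pd ∘ y) (κ.bias ∘ q) H x') ≤
      2 ^ k / ((2 ^ n - 1) * (2 ^ n - 2)) := by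
  refine prodExpect_le_of_forall_le σ.isKernel_mass fun s => ?_
  calc _ ≤ ∑ x, weight (σ.bias ∘ s) x * (2 ^ k / ((2 ^ n - 1) * (2 ^ n - 2))) :=
        sum_le_sum fun x _ => mul_le_mul_of_nonneg_left
          (prodExpect_le_of_forall_le (hW.isKernel s x) fun y =>
            prodExpect_le_of_forall_le κ.isKernel_mass fun q =>
              expect_ind_headVec_mul_weight_mul_decWeight_le h hn hm hpd
                (fun _ => κ.bias_mem _) x y) (σ.weight_bias_nonneg s x)
    _ = _ := by rw [← sum_mul, σ.sum_weight_bias, one_mul]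

lemma prodExpect_ind_le_weight_zero_le {N : ℕ} (hκ : ∑ t, κ.mass t * κ.bias t = 1 / 2)
    (hτ : 0 < τ) :
    prodExpect (fun _ : Fin N => κ.mass) (fun q => ind (τ ≤ weight (κ.bias ∘ q) 0)) ≤
      (1 / 2) ^ N / τ := by
  have hhalf : ∑ t, κ.mass t * (1 - κ.bias t) = 1 / 2 := by
    simp only [mul_sub, mul_one, sum_sub_distrib, κ.mass_mem.2, hκ]
    norm_num
  rw [← hhalf, ← κ.prodExpect_weight_zero, div_eq_mul_inv, ← prodExpect_mul_right]
  exact prodExpect_mono κ.isKernel_mass fun q => ind_le_div hτ (κ.weight_bias_nonneg q 0)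

lemma msgProb_ne_decode_le (hf : IsQuery f) (hW : IsStateChannel W)
    (hpd : ∀ y, pd y ∈ Set.Icc (0 : ℝ) 1) (hκ : ∑ t, κ.mass t * κ.bias t = 1 / 2) (hn : 2 ≤ n)
    (hm : m ≠ 0) (hθ : 0 < θ) (hτ : 0 < τ) :
    msgProb σ κ W m f (fun (H : GL (Fin n) (ZMod 2)) q _ _ y => m ≠ decode f pd H (κ.bias ∘ q) y) ≤
      failProb h σ κ m θ +
        ((idealExpect σ κ W (fun (q : Fin (n - k) → T) v _ (x : Fin n → ZMod 2) y =>
              ind (weight (pd ∘ y) x * weight (κ.bias ∘ q) v < τ)) +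
            (1 / 2) ^ (n - k) / τ) / (2 ^ n - 1) +
          2 ^ k / ((2 ^ n - 1) * (2 ^ n - 2)) / τ) / θ := by
  have hpos : (0 : ℝ) < 2 ^ n - 1 := by linarith [four_le_two_pow hn]
  refine (msgProb_le_failProb_add_weightedExpect h hf hW hθ _).trans ?_
  gcongr
  refine (weightedExpect_mono h hW fun H q _ x y hx => ind_ne_decode_le h hf hpd
    (q := κ.bias ∘ q) (fun _ => κ.bias_mem _) hτ hx y).trans ?_
  rw [weightedExpect_add, weightedExpect_add, add_div]
  gcongr
  · exact weightedExpect_le_idealExpect_div h hW hn hm (F := fun q v _ x y =>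
      ind (weight (pd ∘ y) x * weight (κ.bias ∘ q) v < τ)) fun _ _ _ _ _ => ind_nonneg _
  · refine (weightedExpect_le_idealExpect_div h hW hn hm (F := fun q _ _ _ _ =>
      ind (τ ≤ weight (κ.bias ∘ q) 0)) fun _ _ _ _ _ => ind_nonneg _).trans ?_
    gcongr
    refine (Eq.le ?_).trans (prodExpect_ind_le_weight_zero_le hκ hτ)
    simp only [idealExpect, ← sum_mul, κ.sum_weight_bias,
      one_mul, prodExpect_const (hW.isKernel _ _), σ.sum_weight_bias,
      prodExpect_const σ.isKernel_mass]
  · rw [weightedExpect_div h (fun H q _ x y =>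
      ∑ x' with x' ≠ 0 ∧ x' ≠ x, decWeight h (pd ∘ y) (κ.bias ∘ q) H x')]
    gcongr
    exact weightedExpect_sum_decWeight_le h hW hn hm hpd

end Decoding

/-! ### Failure of the encoder -/

lemma one_sub_sum_mul_le_card_mul {ι : Type*} [Fintype ι] {μ w : ι → ℝ} (hμ : μ ∈ stdSimplex ℝ ι)
    {θ b : ℝ} (hb : 0 ≤ b) [DecidablePred (θ ≤ w ·)] :
    1 - ∑ a, μ a * (ind (w a < θ) + ind (b < μ a)) ≤ #{a | θ ≤ w a} * b := by
  rw [← hμ.2, sub_le_iff_le_add, ← nsmul_eq_mul, ← sum_const, sum_filter, ← sum_add_distrib]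
  refine sum_le_sum fun a _ => ?_
  have hnonneg (p : Prop) : 0 ≤ μ a * ind p := mul_nonneg (hμ.1 a) (ind_nonneg p)
  rw [mul_add]
  split_ifs with hθ
  · rcases le_or_gt (μ a) b with hle | hlt
    · linarith [hnonneg (w a < θ), hnonneg (b < μ a)]
    · rw [ind_of_true hlt]
      linarith [hnonneg (w a < θ)]
  · rw [ind_of_true (not_le.1 hθ)]
    linarith [hnonneg (b < μ a)]

lemma card_le_card_filter_fst_ne_add {α β : Type*} [DecidableEq α] [Fintype β]
    (A : Finset (α × β)) (a : α) : #A ≤ #{c ∈ A | c.1 ≠ a} + Fintype.card β := by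
  rw [← card_filter_add_card_filter_not (s := A) fun c => c.1 ≠ a]
  refine Nat.add_le_add_left (card_le_card_of_injOn Prod.snd (fun _ _ => mem_univ _) ?_) _
  exact fun b hb c hc hbc =>
    Prod.ext ((not_not.1 (mem_filter.1 hb).2).trans (not_not.1 (mem_filter.1 hc).2).symm) hbc

section EncoderFailure

variable {n k : ℕ} (h : k ≤ n) {m : Fin k → ZMod 2} {p p' : Fin n → ℝ} {q q' : Fin (n - k) → ℝ}
  {θ b K : ℝ}

lemma exists_card_eq_headVec_tailVec {α : Type*} (m : Fin k → ZMod 2)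
    (A : Finset (α × (Fin (n - k) → ZMod 2))) :
    ∃ G : Finset (α × (Fin n → ZMod 2)), #G = #A ∧
      ∀ a ∈ G, headVec h a.2 = m ∧ (a.1, tailVec h a.2) ∈ A := by
  classical
  choose z hz_head hz_tail using exists_headVec_tailVec h m
  refine ⟨A.image fun av => (av.1, z av.2), card_image_of_injective _ fun a b hab => ?_, ?_⟩
  · refine Prod.ext (Prod.ext_iff.1 hab).1 ?_
    rw [← hz_tail a.2, ← hz_tail b.2, show z a.2 = z b.2 from congrArg Prod.snd hab]
  · rintro _ ha
    obtain ⟨av, hav, rfl⟩ := mem_image.1 ha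
    exact ⟨hz_head _, by rwa [hz_tail]⟩

lemma expect_ind_forall_encWeight_lt_le_of_card_ge (hn : 2 ≤ n) (hm : m ≠ 0) (hK : 0 < K)
    (hcard : 2 ^ n * (K + 1) ≤ (#{xv : (Fin n → ZMod 2) × (Fin (n - k) → ZMod 2) |
      θ ≤ weight p xv.1 * weight q xv.2} : ℝ)) :
    𝔼 H : GL (Fin n) (ZMod 2), ind (∀ x, encWeight h p m q H x < θ) ≤
      1 / K + 1 / (2 ^ n - 2) := by
  classical
  set A : Finset ((Fin n → ZMod 2) × (Fin (n - k) → ZMod 2)) :=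
    {xv | θ ≤ weight p xv.1 * weight q xv.2}
  set A₀ : Finset ((Fin n → ZMod 2) × (Fin (n - k) → ZMod 2)) := {xv ∈ A | xv.1 ≠ 0}
  have hA₀ : 2 ^ n * K ≤ (#A₀ : ℝ) := by
    have hsplit : (#A : ℝ) ≤ #A₀ + (2 : ℝ) ^ (n - k) := by
      exact_mod_cast (card_le_card_filter_fst_ne_add A 0).trans_eq (by simp [A₀])
    have hpow : (2 : ℝ) ^ (n - k) ≤ 2 ^ n := pow_le_pow_right₀ one_le_two (Nat.sub_le n k)
    linarith
  have hpos : 0 < (#A₀ : ℝ) := lt_of_lt_of_le (by positivity) hA₀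
  obtain ⟨G, hcardG, hmemG⟩ := exists_card_eq_headVec_tailVec h m A₀
  have hG : ∀ a ∈ G, a.1 ≠ 0 ∧ a.2 ≠ 0 := fun a ha =>
    ⟨(mem_filter.1 (hmemG a ha).2).2, fun hz => hm <| by rw [← (hmemG a ha).1, hz]; rfl⟩
  have hne : G.Nonempty := card_pos.1 (hcardG ▸ Nat.cast_pos.1 hpos)
  have hheavy (H : GL (Fin n) (ZMod 2)) (hlt : ∀ x, encWeight h p m q H x < θ) (x) :
      (x, parity H x) ∉ G := by
    intro hx
    obtain ⟨hhead, hmem⟩ := hmemG _ hx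
    have := hlt x
    rw [encWeight, ind_of_true hhead, one_mul] at this
    exact this.not_ge (mem_filter.1 (mem_filter.1 hmem).1).2
  calc _ ≤ (2 ^ n - 1) / (#G : ℝ) + 1 / (2 ^ n - 2) :=
        (expect_le_expect fun H _ => ind_mono (hheavy H)).trans
          (expect_ind_forall_parity_notMem_le hn hG hne)
    _ ≤ 1 / K + 1 / (2 ^ n - 2) := by
        refine add_le_add_left ?_ _
        rw [hcardG, div_le_div_iff₀ hpos hK]
        nlinarith

lemma expect_ind_forall_encWeight_lt_le (hn : 2 ≤ n) (hm : m ≠ 0)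
    (hp' : ∀ i, p' i ∈ Set.Icc (0 : ℝ) 1) (hq' : ∀ j, q' j ∈ Set.Icc (0 : ℝ) 1) (hb : 0 < b)
    (hK : 0 < K) (hbK : 2 ^ n * (2 * (K + 1)) * b ≤ 1) :
    𝔼 H : GL (Fin n) (ZMod 2), ind (∀ x, encWeight h p m q H x < θ) ≤
      2 * (∑ x, weight p' x * ∑ v, weight q' v * (ind (weight p x * weight q v < θ) +
        ind (b < weight p' x * weight q' v))) + (1 / K + 1 / (2 ^ n - 2)) := by
  set a := ∑ x, weight p' x * ∑ v, weight q' v * (ind (weight p x * weight q v < θ) +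
    ind (b < weight p' x * weight q' v)) with ha
  have hn2 : (0 : ℝ) < 2 ^ n - 2 := by linarith [four_le_two_pow hn]
  have ha0 : 0 ≤ a := sum_nonneg fun x _ => mul_nonneg (weight_nonneg hp' x) <|
    sum_nonneg fun v _ => mul_nonneg (weight_nonneg hq' v)
      (add_nonneg (ind_nonneg _) (ind_nonneg _))
  rcases lt_or_ge 1 (2 * a) with hlarge | hsmall
  · have hle_one : 𝔼 H : GL (Fin n) (ZMod 2), ind (∀ x, encWeight h p m q H x < θ) ≤ 1 :=
      (expect_le_expect fun H _ => ind_le_one _).trans_eq (Fintype.expect_const _)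
    have : 0 ≤ 1 / K + 1 / (2 ^ n - 2) := by positivity
    linarith
  · have hμ : (fun xv : (Fin n → ZMod 2) × (Fin (n - k) → ZMod 2) =>
        weight p' xv.1 * weight q' xv.2) ∈ stdSimplex ℝ _ :=
      ⟨fun xv => mul_nonneg (weight_nonneg hp' _) (weight_nonneg hq' _), by
        rw [Fintype.sum_prod_type' fun x v => weight p' x * weight q' v, ← sum_mul_sum,
          sum_weight hp', sum_weight hq', one_mul]⟩
    have hcard := one_sub_sum_mul_le_card_mul (w := fun xv => weight p xv.1 * weight q xv.2)
      (θ := θ) hμ hb.le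
    simp only [Fintype.sum_prod_type, mul_assoc (weight p' _), ← mul_sum] at hcard
    rw [← ha] at hcard
    refine (expect_ind_forall_encWeight_lt_le_of_card_ge h hn hm hK ?_).trans
      (le_add_of_nonneg_left (by positivity))
    exact le_of_mul_le_mul_right (by linarith) hb

end EncoderFailure

section FailProb

variable {S T : Type*} [Fintype S] [Fintype T] {σ σ' : RandomBias S} {κ κ' : RandomBias T}

lemma RandomBias.bitMass_pos_of_joint_ne_zero (σ : RandomBias S) {c : S × ZMod 2}
    (hc : σ.joint c ≠ 0) : 0 < bitMass (σ.bias c.1) c.2 :=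
  (bitMass_nonneg (σ.bias_mem c.1) c.2).lt_of_ne' (right_ne_zero_of_mul hc)

lemma failProb_le_of_mass_eq {n k : ℕ} (h : k ≤ n) {m : Fin k → ZMod 2} (hn : 2 ≤ n) (hm : m ≠ 0)
    (hσ : σ'.mass = σ.mass) (hκ : κ'.mass = κ.mass) {θ b K : ℝ} (hb : 0 < b) (hK : 0 < K)
    (hbK : 2 ^ n * (2 * (K + 1)) * b ≤ 1) :
    failProb h σ κ m θ ≤
      2 * prodExpect (fun _ : Fin n => σ'.joint) (fun c =>
        prodExpect (fun _ : Fin (n - k) => κ'.joint) fun d =>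
          ind (weight (σ.bias ∘ Prod.fst ∘ c) (Prod.snd ∘ c) *
              weight (κ.bias ∘ Prod.fst ∘ d) (Prod.snd ∘ d) < θ) +
            ind (b < weight (σ'.bias ∘ Prod.fst ∘ c) (Prod.snd ∘ c) *
              weight (κ'.bias ∘ Prod.fst ∘ d) (Prod.snd ∘ d))) +
        (1 / K + 1 / (2 ^ n - 2)) := by
  have hjoint := σ'.prodExpect_joint (n := n) fun s x =>
    prodExpect (fun _ : Fin (n - k) => κ'.joint) fun d =>
      ind (weight (σ.bias ∘ s) x * weight (κ.bias ∘ Prod.fst ∘ d) (Prod.snd ∘ d) < θ) +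
        ind (b < weight (σ'.bias ∘ s) x * weight (κ'.bias ∘ Prod.fst ∘ d) (Prod.snd ∘ d))
  have hjoint' (s : Fin n → S) (x) := κ'.prodExpect_joint (n := n - k) fun q v =>
    ind (weight (σ.bias ∘ s) x * weight (κ.bias ∘ q) v < θ) +
      ind (b < weight (σ'.bias ∘ s) x * weight (κ'.bias ∘ q) v)
  rw [hjoint]
  simp only [hjoint', hσ, hκ]
  refine (prodExpect_mono σ.isKernel_mass fun s => prodExpect_mono κ.isKernel_mass fun q =>
    expect_ind_forall_encWeight_lt_le h (p' := σ'.bias ∘ s) (q' := κ'.bias ∘ q) hn hm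
      (fun _ => σ'.bias_mem _) (fun _ => κ'.bias_mem _) hb hK hbK).trans_eq ?_
  simp only [prodExpect_add, prodExpect_mul_left, prodExpect_sum,
    prodExpect_const κ.isKernel_mass, prodExpect_const σ.isKernel_mass, Function.comp_def]

/-- `H(B' ; B)` in nats for random letters with bits `B'` and `B`: the mean of `-log P(B = b)` over
the letter and the value `b` of the bit `B'`. -/
noncomputable def RandomBias.crossEntropy (σ' σ : RandomBias S) : ℝ :=
  ∑ c, σ'.joint c * -Real.log (bitMass (σ.bias c.1) c.2)

/-- The conditional entropy, in nats, of the bit given the letter. -/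
noncomputable def RandomBias.entropy (σ : RandomBias S) : ℝ :=
  ∑ s, σ.mass s * Real.binEntropy (σ.bias s)

lemma RandomBias.crossEntropy_self (σ : RandomBias S) : σ.crossEntropy σ = σ.entropy := by
  simp only [crossEntropy, entropy, joint, compProd, Fintype.sum_prod_type, sum_zmod_two,
    bitMass_zero, bitMass_one, Real.binEntropy, Real.log_inv]
  exact sum_congr rfl fun s _ => by ring

/-- At rate `R`, the probability that no word has encoder weight at least `2⁻ⁿ exp (-δ n)` tends to
`0` with the blocklength `n`, uniformly over the nonzero messages. -/
def FailureVanishes (R δ : ℝ) (σ : RandomBias S) (κ : RandomBias T) : Prop :=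
  ∃ u : ℕ → ℝ, Tendsto u atTop (𝓝 0) ∧ ∀ᶠ n : ℕ in atTop, ∀ (h : ⌊n * R⌋₊ ≤ n) m, m ≠ 0 →
    failProb h σ κ m (Real.exp (-(n * (Real.log 2 + δ)))) ≤ u n

lemma floor_mul_le_self {R : ℝ} (hR1 : R ≤ 1) (n : ℕ) : ⌊n * R⌋₊ ≤ n :=
  Nat.floor_le_of_le (mul_le_of_le_one_right (Nat.cast_nonneg n) hR1)

lemma tendsto_sub_floor_div {R : ℝ} (hR : 0 ≤ R) (hR1 : R ≤ 1) :
    Tendsto (fun n : ℕ => ((n - ⌊n * R⌋₊ : ℕ) : ℝ) / n) atTop (𝓝 (1 - R)) := by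
  refine (((tendsto_nat_floor_mul_div_atTop hR).comp tendsto_natCast_atTop_atTop).const_sub
    1).congr' ?_
  filter_upwards [eventually_gt_atTop 0] with n hn
  rw [Nat.cast_sub (floor_mul_le_self hR1 n), sub_div, div_self (Nat.cast_pos.2 hn).ne',
    mul_comm (n : ℝ)]
  rfl

lemma tendsto_exp_neg_mul {r : ℝ} (hr : 0 < r) :
    Tendsto (fun n : ℕ => Real.exp (-(r * n))) atTop (𝓝 0) :=
  Real.tendsto_exp_neg_atTop_nhds_zero.comp (tendsto_natCast_atTop_atTop.const_mul_atTop hr)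

lemma two_pow_eq_exp (n : ℕ) : (2 : ℝ) ^ n = Real.exp (n * Real.log 2) := by
  rw [Real.exp_nat_mul, Real.exp_log two_pos]

lemma tendsto_one_div_add_one_div {ε : ℝ} (hε : 0 < ε) :
    Tendsto (fun n : ℕ => 1 / (Real.exp (ε * n) / 2 - 1) + 1 / ((2 : ℝ) ^ n - 2))
      atTop (𝓝 0) := by
  have hexp : Tendsto (fun n : ℕ => Real.exp (ε * n) / 2 - 1) atTop atTop :=
    tendsto_atTop_add_const_right _ _ ((Real.tendsto_exp_atTop.comp
      (tendsto_natCast_atTop_atTop.const_mul_atTop hε)).atTop_div_const two_pos)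
  have hpow : Tendsto (fun n : ℕ => (2 : ℝ) ^ n - 2) atTop atTop :=
    tendsto_atTop_add_const_right _ _ (tendsto_pow_atTop_atTop_of_one_lt one_lt_two)
  simpa using (hexp.const_div_atTop 1).add (hpow.const_div_atTop 1)

lemma failureVanishes_of_crossEntropy_lt {R δ : ℝ} (hR : 0 ≤ R) (hR1 : R < 1)
    (hσ : σ'.mass = σ.mass) (hκ : κ'.mass = κ.mass)
    (hσpos : ∀ c, σ'.joint c ≠ 0 → 0 < bitMass (σ.bias c.1) c.2)
    (hκpos : ∀ d, κ'.joint d ≠ 0 → 0 < bitMass (κ.bias d.1) d.2)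
    (hcross : σ'.crossEntropy σ + (1 - R) * κ'.crossEntropy κ < Real.log 2 + δ)
    (hent : Real.log 2 < σ'.entropy + (1 - R) * κ'.entropy) :
    FailureVanishes R δ σ κ := by
  obtain ⟨ε, hε, hεent⟩ : ∃ ε : ℝ, 0 < ε ∧
      Real.log 2 + ε < σ'.crossEntropy σ' + (1 - R) * κ'.crossEntropy κ' := by
    rw [σ'.crossEntropy_self, κ'.crossEntropy_self]
    exact ⟨(σ'.entropy + (1 - R) * κ'.entropy - Real.log 2) / 2, by linarith, by linarith⟩
  have hN := tendsto_sub_floor_div hR hR1.le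
  obtain ⟨r₁, hr₁, h₁⟩ := exists_prodExpect_ind_mul_lt_le_exp σ'.joint_mem_stdSimplex
    κ'.joint_mem_stdSimplex hσpos hκpos (sub_pos.2 hR1) hN hcross
  obtain ⟨r₂, hr₂, h₂⟩ := exists_prodExpect_ind_lt_mul_le_exp σ'.joint_mem_stdSimplex
    κ'.joint_mem_stdSimplex (fun _ => σ'.bitMass_pos_of_joint_ne_zero)
    (fun _ => κ'.bitMass_pos_of_joint_ne_zero) (sub_pos.2 hR1) hN hεent
  refine ⟨fun n => 2 * (Real.exp (-(r₁ * n)) + Real.exp (-(r₂ * n))) +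
    (1 / (Real.exp (ε * n) / 2 - 1) + 1 / (2 ^ n - 2)), ?_, ?_⟩
  · simpa using (((tendsto_exp_neg_mul hr₁).add (tendsto_exp_neg_mul hr₂)).const_mul 2).add
      (tendsto_one_div_add_one_div hε)
  have hK : ∀ᶠ n : ℕ in atTop, 2 < Real.exp (ε * n) :=
    (Real.tendsto_exp_atTop.comp
      (tendsto_natCast_atTop_atTop.const_mul_atTop hε)).eventually_gt_atTop 2
  filter_upwards [h₁, h₂, hK, eventually_ge_atTop 2] with n h₁ h₂ hK hn h m hm
  have hbK : 2 ^ n * (2 * (Real.exp (ε * n) / 2 - 1 + 1)) *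
      Real.exp (-(n * (Real.log 2 + ε))) = 1 := by
    rw [sub_add_cancel, mul_div_cancel₀ _ two_ne_zero, two_pow_eq_exp, ← Real.exp_add,
      ← Real.exp_add, Real.exp_eq_one_iff]
    ring
  refine (failProb_le_of_mass_eq h hn hm hσ hκ (Real.exp_pos _) (by linarith) hbK.le).trans ?_
  simp only [prodExpect_add]
  gcongr
  exacts [h₁, h₂]

end FailProb

section Tilt

open Classical in
/-- The bias `p` moved towards `1/2` by the fraction `l`, except that the biases `0` and `1` are
kept, since a word with a zero factor in its weight can never be made likely. -/
noncomputable def tiltBias (l p : ℝ) : ℝ := if p = 0 ∨ p = 1 then p else (1 - l) * p + l / 2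

variable {l p : ℝ}

lemma tiltBias_mem (hl : l ∈ Set.Icc (0 : ℝ) 1) (hp : p ∈ Set.Icc (0 : ℝ) 1) :
    tiltBias l p ∈ Set.Icc (0 : ℝ) 1 := by
  obtain ⟨hl0, hl1⟩ := hl
  obtain ⟨hp0, hp1⟩ := hp
  unfold tiltBias
  split_ifs
  · exact ⟨hp0, hp1⟩
  · constructor <;> nlinarith

lemma tiltBias_zero (p : ℝ) : tiltBias 0 p = p := by
  simp only [tiltBias, sub_zero, one_mul, zero_div, add_zero, ite_self]

lemma tiltBias_of_mem (hp : p ∈ ({0, 1 / 2, 1} : Set ℝ)) : tiltBias l p = p := by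
  unfold tiltBias
  split_ifs with h01
  · rfl
  · obtain rfl : p = 1 / 2 := by
      simp only [Set.mem_insert_iff, Set.mem_singleton_iff] at hp
      tauto
    ring

lemma continuous_tiltBias (p : ℝ) : Continuous fun l => tiltBias l p := by
  unfold tiltBias
  split_ifs <;> fun_prop

lemma bitMass_pos_of_bitMass_tiltBias_ne_zero (hp : p ∈ Set.Icc (0 : ℝ) 1) {b : ZMod 2}
    (hb : bitMass (tiltBias l p) b ≠ 0) : 0 < bitMass p b := by
  by_cases h01 : p = 0 ∨ p = 1
  · rw [tiltBias, if_pos h01] at hb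
    exact (bitMass_nonneg hp b).lt_of_ne' hb
  · obtain ⟨h0, h1⟩ := not_or.1 h01
    unfold bitMass
    split_ifs
    exacts [hp.1.lt_of_ne' h0, sub_pos.2 (hp.2.lt_of_ne h1)]

lemma binEntropy_lt_binEntropy_tiltBias (hl : l ∈ Set.Ioo (0 : ℝ) 1) (hp : p ∈ Set.Icc (0 : ℝ) 1)
    (hne : p ∉ ({0, 1 / 2, 1} : Set ℝ)) :
    Real.binEntropy p < Real.binEntropy (tiltBias l p) := by
  simp only [Set.mem_insert_iff, Set.mem_singleton_iff, not_or] at hne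
  have hconcave := Real.strictConcave_binEntropy.2 hp
    (show (1 / 2 : ℝ) ∈ Set.Icc 0 1 by norm_num) hne.2.1 (sub_pos.2 hl.2) hl.1 (sub_add_cancel 1 l)
  simp only [smul_eq_mul, one_div, Real.binEntropy_two_inv] at hconcave
  rw [tiltBias, if_neg (not_or.2 ⟨hne.1, hne.2.2⟩), div_eq_mul_inv]
  nlinarith [hl.1, Real.binEntropy_le_log_two (p := p)]

lemma binEntropy_le_binEntropy_tiltBias (hl : l ∈ Set.Ioo (0 : ℝ) 1)
    (hp : p ∈ Set.Icc (0 : ℝ) 1) : Real.binEntropy p ≤ Real.binEntropy (tiltBias l p) := by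
  by_cases hmem : p ∈ ({0, 1 / 2, 1} : Set ℝ)
  · rw [tiltBias_of_mem hmem]
  · exact (binEntropy_lt_binEntropy_tiltBias hl hp hmem).le

end Tilt

namespace RandomBias

variable {S : Type*} [Fintype S] (σ : RandomBias S)

/-- The letters of `σ`, with their biases moved towards `1/2` by the fraction `l`. -/
noncomputable def tilt (l : unitInterval) : RandomBias S where
  mass := σ.mass
  bias s := tiltBias l (σ.bias s)
  mass_mem := σ.mass_mem
  bias_mem s := tiltBias_mem l.2 (σ.bias_mem s)

lemma tilt_zero : σ.tilt 0 = σ := by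
  simp only [tilt, Set.Icc.coe_zero, tiltBias_zero]

lemma continuous_crossEntropy_tilt :
    Continuous fun l : unitInterval => (σ.tilt l).crossEntropy σ := by
  refine continuous_finsetSum _ fun c _ => Continuous.mul (continuous_const.mul ?_) continuous_const
  have htilt : Continuous fun l : unitInterval => tiltBias l (σ.bias c.1) :=
    (continuous_tiltBias (σ.bias c.1)).comp continuous_subtype_val
  by_cases hc : c.2 = 1
  · simpa only [tilt, bitMass, if_pos hc] using htilt
  · simp only [tilt, bitMass, if_neg hc]
    fun_prop

variable {σ} {l : unitInterval} (hl : (l : ℝ) ∈ Set.Ioo (0 : ℝ) 1)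
include hl

lemma entropy_le_entropy_tilt : σ.entropy ≤ (σ.tilt l).entropy :=
  sum_le_sum fun s _ => mul_le_mul_of_nonneg_left
    (binEntropy_le_binEntropy_tiltBias hl (σ.bias_mem s)) (σ.mass_mem.1 s)

lemma entropy_lt_entropy_tilt
    (h : ∃ s, σ.mass s ≠ 0 ∧ σ.bias s ∉ ({0, 1 / 2, 1} : Set ℝ)) :
    σ.entropy < (σ.tilt l).entropy := by
  obtain ⟨s, hs, hne⟩ := h
  refine sum_lt_sum (fun s _ => mul_le_mul_of_nonneg_left
    (binEntropy_le_binEntropy_tiltBias hl (σ.bias_mem s)) (σ.mass_mem.1 s)) ⟨s, mem_univ s, ?_⟩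
  exact mul_lt_mul_of_pos_left (binEntropy_lt_binEntropy_tiltBias hl (σ.bias_mem s) hne)
    ((σ.mass_mem.1 s).lt_of_ne' hs)

end RandomBias

section FailureVanishes

variable {S T : Type*} [Fintype S] [Fintype T] {σ : RandomBias S} {κ : RandomBias T} {R δ : ℝ}

lemma failureVanishes_of_exists (hR : 0 ≤ R) (hR1 : R < 1) (hδ : 0 < δ)
    (hbal : σ.entropy + (1 - R) * κ.entropy = Real.log 2)
    (hnd : (∃ s, σ.mass s ≠ 0 ∧ σ.bias s ∉ ({0, 1 / 2, 1} : Set ℝ)) ∨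
      ∃ t, κ.mass t ≠ 0 ∧ κ.bias t ∉ ({0, 1 / 2, 1} : Set ℝ)) :
    FailureVanishes R δ σ κ := by
  have hcont : Continuous fun l : unitInterval =>
      (σ.tilt l).crossEntropy σ + (1 - R) * (κ.tilt l).crossEntropy κ :=
    σ.continuous_crossEntropy_tilt.add (continuous_const.mul κ.continuous_crossEntropy_tilt)
  have hlt : ∀ᶠ l : unitInterval in 𝓝 0,
      (σ.tilt l).crossEntropy σ + (1 - R) * (κ.tilt l).crossEntropy κ < Real.log 2 + δ := by
    refine hcont.continuousAt.eventually_lt continuousAt_const ?_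
    rw [σ.tilt_zero, κ.tilt_zero, σ.crossEntropy_self, κ.crossEntropy_self, hbal]
    exact lt_add_of_pos_right _ hδ
  have : (𝓝[>] (0 : unitInterval)).NeBot := nhdsGT_neBot_of_exists_gt ⟨1, zero_lt_one⟩
  obtain ⟨l, hl, hIoo⟩ := ((hlt.filter_mono nhdsWithin_le_nhds).and
    (Ioo_mem_nhdsGT (zero_lt_one : (0 : unitInterval) < 1))).exists
  have hl01 : (l : ℝ) ∈ Set.Ioo (0 : ℝ) 1 := ⟨hIoo.1, hIoo.2⟩
  refine failureVanishes_of_crossEntropy_lt (σ' := σ.tilt l) (κ' := κ.tilt l) hR hR1 rfl rfl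
    (fun c hc => bitMass_pos_of_bitMass_tiltBias_ne_zero (σ.bias_mem _) (right_ne_zero_of_mul hc))
    (fun d hd => bitMass_pos_of_bitMass_tiltBias_ne_zero (κ.bias_mem _) (right_ne_zero_of_mul hd))
    hl ?_
  rw [← hbal]
  rcases hnd with hσ | hκ
  · exact add_lt_add_of_lt_of_le (RandomBias.entropy_lt_entropy_tilt hl01 hσ)
      (mul_le_mul_of_nonneg_left (RandomBias.entropy_le_entropy_tilt hl01) (sub_nonneg.2 hR1.le))
  · exact add_lt_add_of_le_of_lt (RandomBias.entropy_le_entropy_tilt hl01)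
      (mul_lt_mul_of_pos_left (RandomBias.entropy_lt_entropy_tilt hl01 hκ) (sub_pos.2 hR1))

lemma exists_encWeight_eq_half_pow {n k : ℕ} (h : k ≤ n) (m : Fin k → ZMod 2) {q : Fin (n - k) → ℝ}
    (hq : ∀ j, q j = 0 ∨ q j = 1) (H : GL (Fin n) (ZMod 2)) :
    ∃ x, encWeight h (fun _ => 1 / 2) m q H x = (1 / 2) ^ n := by
  obtain ⟨z, hz_head, hz_tail⟩ :=
    exists_headVec_tailVec h m fun j => if q j = 1 then (1 : ZMod 2) else 0
  obtain ⟨x, rfl⟩ := Finite.injective_iff_surjective.1 (parity_injective H) z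
  have hbits : (fun j => if tailVec h (parity H x) j = 1 then (1 : ℝ) else 0) = q := by
    funext j
    rw [hz_tail]
    rcases hq j with hj | hj <;> simp [hj]
  have hweight := weight_bits (tailVec h (parity H x)) (tailVec h (parity H x))
  rw [hbits, ind_of_true rfl] at hweight
  exact ⟨x, by rw [encWeight, weight_half, ind_of_true hz_head, hweight, one_mul, mul_one]⟩

lemma failProb_nonpos_of_half {n k : ℕ} (h : k ≤ n) (m : Fin k → ZMod 2)
    (hσ : ∀ s, σ.mass s ≠ 0 → σ.bias s = 1 / 2)
    (hκ : ∀ t, κ.mass t ≠ 0 → κ.bias t = 0 ∨ κ.bias t = 1) {θ : ℝ} (hθ : θ ≤ (1 / 2) ^ n) :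
    failProb h σ κ m θ ≤ 0 := by
  refine (prodExpect_mono_of_support σ.isKernel_mass fun s hs => ?_).trans_eq
    (prodExpect_const σ.isKernel_mass 0)
  refine (prodExpect_mono_of_support κ.isKernel_mass fun q hq => ?_).trans_eq
    (prodExpect_const κ.isKernel_mass 0)
  refine (expect_eq_zero fun H _ => ind_of_false ?_).le
  obtain ⟨x, hx⟩ := exists_encWeight_eq_half_pow h m (q := κ.bias ∘ q) (fun j => hκ _ (hq j)) H
  rw [show σ.bias ∘ s = fun _ => 1 / 2 from funext fun i => hσ _ (hs i)]
  exact fun hlt => (hx ▸ hlt x).not_ge hθ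

lemma failureVanishes_of_half (hδ : 0 < δ) (hσ : ∀ s, σ.mass s ≠ 0 → σ.bias s = 1 / 2)
    (hκ : ∀ t, κ.mass t ≠ 0 → κ.bias t = 0 ∨ κ.bias t = 1) : FailureVanishes R δ σ κ := by
  refine ⟨fun _ => 0, tendsto_const_nhds, Eventually.of_forall fun n h m _ =>
    failProb_nonpos_of_half h m hσ hκ ?_⟩
  rw [one_div, inv_pow, two_pow_eq_exp, ← Real.exp_neg]
  gcongr
  exact le_add_of_nonneg_right hδ.le

lemma RandomBias.entropy_eq_log_two_of_half (h : ∀ s, σ.mass s ≠ 0 → σ.bias s = 1 / 2) :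
    σ.entropy = Real.log 2 := by
  rw [← one_mul (Real.log 2), ← σ.mass_mem.2, sum_mul]
  refine sum_congr rfl fun s _ => ?_
  by_cases hs : σ.mass s = 0
  · rw [hs, zero_mul, zero_mul]
  · rw [h s hs, one_div, Real.binEntropy_two_inv]

lemma RandomBias.bias_eq_zero_or_one_of_entropy_eq_zero (h : σ.entropy = 0) {s : S}
    (hs : σ.mass s ≠ 0) : σ.bias s = 0 ∨ σ.bias s = 1 := by
  have hterm := (sum_eq_zero_iff_of_nonneg fun s _ => mul_nonneg (σ.mass_mem.1 s)
    (Real.binEntropy_nonneg (σ.bias_mem s).1 (σ.bias_mem s).2)).1 h s (mem_univ s)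
  exact Real.binEntropy_eq_zero.1 ((mul_eq_zero.1 hterm).resolve_left hs)

lemma failureVanishes (hR : 0 ≤ R) (hR1 : R < 1) (hδ : 0 < δ)
    (hbal : σ.entropy + (1 - R) * κ.entropy = Real.log 2)
    (hnd : (∃ s, σ.mass s ≠ 0 ∧ σ.bias s ∉ ({0, 1 / 2, 1} : Set ℝ)) ∨
      (∃ t, κ.mass t ≠ 0 ∧ κ.bias t ∉ ({0, 1 / 2, 1} : Set ℝ)) ∨
      ∀ s, σ.mass s ≠ 0 → σ.bias s ∉ ({0, 1} : Set ℝ)) :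
    FailureVanishes R δ σ κ := by
  rw [← or_assoc] at hnd
  by_cases hex : (∃ s, σ.mass s ≠ 0 ∧ σ.bias s ∉ ({0, 1 / 2, 1} : Set ℝ)) ∨
      ∃ t, κ.mass t ≠ 0 ∧ κ.bias t ∉ ({0, 1 / 2, 1} : Set ℝ)
  · exact failureVanishes_of_exists hR hR1 hδ hbal hex
  have hhalf : ∀ s, σ.mass s ≠ 0 → σ.bias s = 1 / 2 := by
    intro s hs
    have h01 := hnd.resolve_left hex s hs
    have h012 := not_exists.1 (not_or.1 hex).1 s
    simp only [Set.mem_insert_iff, Set.mem_singleton_iff] at h01 h012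
    tauto
  have hκ : κ.entropy = 0 := by
    rw [RandomBias.entropy_eq_log_two_of_half hhalf, add_eq_left] at hbal
    exact (mul_eq_zero.1 hbal).resolve_left (sub_pos.2 hR1).ne'
  exact failureVanishes_of_half hδ hhalf fun t =>
    RandomBias.bias_eq_zero_or_one_of_entropy_eq_zero hκ

end FailureVanishes

/-! ### Information quantities in nats -/

section Entropy

variable {A B : Type*} [Fintype A]

lemma entropy_mul_log_two (p : A → ℝ) : entropy p * Real.log 2 = -∑ a, p a * Real.log (p a) := by
  have : Real.log 2 ≠ 0 := (Real.log_pos one_lt_two).ne'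
  simp only [entropy, Real.logb, neg_mul, sum_mul]
  congr! 2
  field_simp

lemma sum_jointXS {P : B → ℝ} {K : B → A → ℝ} (hK : IsKernel K) (b : B) :
    ∑ a, jointXS P K a b = P b := by
  simp only [jointXS, ← mul_sum, (hK b).2, mul_one]

variable [Fintype B]

lemma entropy_sub_entropy_marginal {J : A → B → ℝ} (hJ : ∀ a b, 0 ≤ J a b) :
    (entropy (fun ab : A × B => J ab.1 ab.2) - entropy fun b => ∑ a, J a b) * Real.log 2 =
      ∑ a, ∑ b, J a b * -Real.log (J a b / ∑ a', J a' b) := by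
  conv_rhs => rw [sum_comm]
  rw [sub_mul, entropy_mul_log_two, entropy_mul_log_two, Fintype.sum_prod_type_right,
    sub_neg_eq_add, ← sum_neg_distrib, ← sum_add_distrib]
  refine sum_congr rfl fun b _ => ?_
  rw [sum_mul, ← sum_neg_distrib, ← sum_add_distrib]
  refine sum_congr rfl fun a _ => ?_
  rcases (hJ a b).eq_or_lt with h0 | hpos
  · simp only [← h0, zero_mul, neg_zero, add_zero]
  · have hmarg : 0 < ∑ a', J a' b :=
      hpos.trans_le (single_le_sum (fun a' _ => hJ a' b) (mem_univ a))
    rw [Real.log_div hpos.ne' hmarg.ne']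
    ring

lemma mul_log_mul (a b : ℝ) :
    a * b * Real.log (a * b) = b * (a * Real.log a) + a * (b * Real.log b) := by
  simpa only [Real.negMulLog, neg_mul, mul_neg, ← neg_add, neg_inj] using Real.negMulLog_mul a b

lemma entropy_jointXS {P : B → ℝ} {K : B → A → ℝ} (hK : IsKernel K) :
    entropy (fun ab : A × B => jointXS P K ab.1 ab.2) = entropy P + condEntropy P K := by
  refine mul_right_cancel₀ (Real.log_pos one_lt_two).ne' ?_
  rw [add_mul, entropy_mul_log_two, entropy_mul_log_two, condEntropy, sum_mul,
    Fintype.sum_prod_type_right]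
  simp only [jointXS, mul_assoc (P _) (entropy _), entropy_mul_log_two, mul_log_mul,
    sum_add_distrib, ← sum_mul, ← mul_sum, (hK _).2, one_mul, mul_neg, sum_neg_distrib, neg_add]

end Entropy

section Binary

variable {p : ZMod 2 → ℝ} (hp : p ∈ stdSimplex ℝ (ZMod 2))
include hp

lemma bitMass_apply_one (b : ZMod 2) : bitMass (p 1) b = p b := by
  have hsum := (sum_zmod_two p).symm.trans hp.2
  unfold bitMass
  split_ifs with hb
  · rw [hb]
  · rw [show b = 0 by revert b; decide, ← hsum, add_sub_cancel_right]

lemma apply_one_mem_Icc : p 1 ∈ Set.Icc (0 : ℝ) 1 :=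
  ⟨hp.1 1, (single_le_sum (fun b _ => hp.1 b) (mem_univ 1)).trans_eq hp.2⟩

lemma entropy_mul_log_two_eq_binEntropy : entropy p * Real.log 2 = Real.binEntropy (p 1) := by
  rw [entropy_mul_log_two, sum_zmod_two, ← bitMass_apply_one hp 0, bitMass_zero, Real.binEntropy,
    Real.log_inv, Real.log_inv]
  ring

end Binary

lemma condEntropy_mul_log_two {S : Type*} [Fintype S] {PS : S → ℝ} {PX : S → ZMod 2 → ℝ}
    (hPX : IsKernel PX) :
    condEntropy PS PX * Real.log 2 = ∑ s, PS s * Real.binEntropy (PX s 1) := by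
  simp only [condEntropy, sum_mul, mul_assoc, entropy_mul_log_two_eq_binEntropy (hPX _)]

section Joint

variable {S U Y : Type*} [Fintype S] [Fintype Y] {PS : S → ℝ} {PX : S → U → ℝ}
  {W : S → U → Y → ℝ}

lemma sum_jointXY (hW : IsStateChannel W) (x : U) :
    ∑ y, jointXY PS PX W x y = ∑ s, jointXS PS PX x s := by
  simp only [jointXY, jointXS]
  rw [sum_comm]
  simp only [← mul_sum, (hW _ x).2, mul_one]

lemma jointXY_nonneg [Fintype U] (hPS : PS ∈ stdSimplex ℝ S) (hPX : IsKernel PX)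
    (hW : IsStateChannel W) (x : U) (y : Y) : 0 ≤ jointXY PS PX W x y :=
  sum_nonneg fun s _ => mul_nonneg (mul_nonneg (hPS.1 s) ((hPX s).1 x)) ((hW s x).1 y)

lemma jointXY_ne_zero [Fintype U] (hPS : PS ∈ stdSimplex ℝ S) (hPX : IsKernel PX)
    (hW : IsStateChannel W) {s : S} {x : U} {y : Y} (h : PS s * PX s x * W s x y ≠ 0) :
    jointXY PS PX W x y ≠ 0 := by
  have hnonneg (s : S) : 0 ≤ PS s * PX s x * W s x y :=
    mul_nonneg (mul_nonneg (hPS.1 s) ((hPX s).1 x)) ((hW s x).1 y)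
  exact (sum_pos' (fun s _ => hnonneg s) ⟨s, mem_univ s, (hnonneg s).lt_of_ne' h⟩).ne'

end Joint

section DecoderBias

variable {S Y : Type*} [Fintype S] {PS : S → ℝ} {PX : S → ZMod 2 → ℝ} {W : S → ZMod 2 → Y → ℝ}

lemma bitMass_decBias {y : Y} (hy : ∑ x, jointXY PS PX W x y ≠ 0) (x : ZMod 2) :
    bitMass (decBias PS PX W y) x = jointXY PS PX W x y / ∑ x, jointXY PS PX W x y := by
  unfold bitMass decBias
  split_ifs with hx
  · rw [hx]
  · rw [one_sub_div hy, show x = 0 by revert x; decide, sum_zmod_two, add_sub_cancel_right]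

variable [Fintype Y]

/-- The conditional entropy `H(X|Y)`, in nats, of the input given the output. -/
noncomputable def outputCondEntropy (PS : S → ℝ) (PX : S → ZMod 2 → ℝ) (W : S → ZMod 2 → Y → ℝ) :
    ℝ :=
  ∑ x, ∑ y, jointXY PS PX W x y * -Real.log (bitMass (decBias PS PX W y) x)

variable (hPS : PS ∈ stdSimplex ℝ S) (hPX : IsKernel PX) (hW : IsStateChannel W)
include hPS hPX hW

lemma decBias_mem (y : Y) : decBias PS PX W y ∈ Set.Icc (0 : ℝ) 1 := by
  have hnonneg (x) := jointXY_nonneg hPS hPX hW x y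
  exact ⟨div_nonneg (hnonneg 1) (sum_nonneg fun x _ => hnonneg x), div_le_one_of_le₀
    (single_le_sum (fun x _ => hnonneg x) (mem_univ 1)) (sum_nonneg fun x _ => hnonneg x)⟩

lemma marginal_pos_of_jointXY_ne_zero {x : ZMod 2} {y : Y} (h : jointXY PS PX W x y ≠ 0) :
    0 < ∑ x, jointXY PS PX W x y :=
  ((jointXY_nonneg hPS hPX hW x y).lt_of_ne' h).trans_le
    (single_le_sum (fun x _ => jointXY_nonneg hPS hPX hW x y) (mem_univ x))

lemma bitMass_decBias_pos {x : ZMod 2} {y : Y} (h : jointXY PS PX W x y ≠ 0) :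
    0 < bitMass (decBias PS PX W y) x := by
  have hmarg := marginal_pos_of_jointXY_ne_zero hPS hPX hW h
  rw [bitMass_decBias hmarg.ne']
  exact div_pos ((jointXY_nonneg hPS hPX hW x y).lt_of_ne' h) hmarg

lemma outputCondEntropy_nonneg : 0 ≤ outputCondEntropy PS PX W := by
  refine sum_nonneg fun x _ => sum_nonneg fun y _ =>
    mul_nonneg (jointXY_nonneg hPS hPX hW x y) (neg_nonneg.2 ?_)
  have hmem := bitMass_mem_stdSimplex (decBias_mem hPS hPX hW y)
  exact Real.log_nonpos (hmem.1 x)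
    ((single_le_sum (fun b _ => hmem.1 b) (mem_univ x)).trans_eq hmem.2)

lemma outputCondEntropy_eq :
    outputCondEntropy PS PX W = (entropy (fun xy : ZMod 2 × Y => jointXY PS PX W xy.1 xy.2) -
      entropy fun y => ∑ x, jointXY PS PX W x y) * Real.log 2 := by
  rw [entropy_sub_entropy_marginal (jointXY_nonneg hPS hPX hW), outputCondEntropy]
  refine sum_congr rfl fun x _ => sum_congr rfl fun y _ => ?_
  by_cases h : jointXY PS PX W x y = 0
  · rw [h, zero_mul, zero_mul]
  · rw [bitMass_decBias (marginal_pos_of_jointXY_ne_zero hPS hPX hW h).ne']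

lemma gpRate_mul_log_two :
    gpRate PS PX W * Real.log 2 =
      condEntropy PS PX * Real.log 2 - outputCondEntropy PS PX W := by
  rw [outputCondEntropy_eq hPS hPX hW, gpRate, mutualInfo, mutualInfo, entropy_jointXS hPX]
  simp only [sum_jointXY hW, sum_jointXS hPX]
  ring

end DecoderBias

/-! ### Vanishing decoding errors -/

lemma inv_two_pow_sub_one_le {n : ℕ} (hn : 2 ≤ n) :
    ((2 : ℝ) ^ n - 1)⁻¹ ≤ 2 * Real.exp (-(n * Real.log 2)) := by
  rw [Real.exp_neg, ← two_pow_eq_exp, ← inv_inv (2 : ℝ), ← mul_inv, inv_inv]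
  exact inv_anti₀ (by positivity) (by linarith [four_le_two_pow hn])

lemma inv_two_pow_sub_two_le {n : ℕ} (hn : 2 ≤ n) :
    ((2 : ℝ) ^ n - 2)⁻¹ ≤ 2 * Real.exp (-(n * Real.log 2)) := by
  rw [Real.exp_neg, ← two_pow_eq_exp, ← inv_inv (2 : ℝ), ← mul_inv, inv_inv]
  exact inv_anti₀ (by positivity) (by linarith [four_le_two_pow hn])

lemma decoding_error_le {n k : ℕ} (hn : 2 ≤ n) (hkn : k ≤ n) {A θ τ r δ ε : ℝ}
    (hA : A ≤ Real.exp (-(r * n))) (hτ : 2 ^ k / τ ≤ Real.exp (n * (Real.log 2 - ε)))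
    (hθ : θ = Real.exp (-(n * (Real.log 2 + δ)))) :
    ((A + (1 / 2) ^ (n - k) / τ) / (2 ^ n - 1) + 2 ^ k / ((2 ^ n - 1) * (2 ^ n - 2)) / τ) / θ ≤
      2 * Real.exp (-((r - δ) * n)) + 6 * Real.exp (-((ε - δ) * n)) := by
  have hhalf : ((1 : ℝ) / 2) ^ (n - k) = 2 ^ k * Real.exp (-(n * Real.log 2)) := by
    rw [Real.exp_neg, ← two_pow_eq_exp, one_div, inv_pow, pow_sub₀ _ two_ne_zero hkn, mul_inv,
      inv_inv, mul_comm]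
  have hpos : (0 : ℝ) < 2 ^ n - 1 := by linarith [four_le_two_pow hn]
  have hpos' : (0 : ℝ) < 2 ^ n - 2 := by linarith [four_le_two_pow hn]
  calc _ = (A + 2 ^ k / τ * Real.exp (-(n * Real.log 2))) * (2 ^ n - 1)⁻¹ * θ⁻¹ +
        2 ^ k / τ * (2 ^ n - 1)⁻¹ * (2 ^ n - 2)⁻¹ * θ⁻¹ := by
        rw [hhalf]; field_simp
    _ ≤ (Real.exp (-(r * n)) + Real.exp (n * (Real.log 2 - ε)) * Real.exp (-(n * Real.log 2))) *
          (2 * Real.exp (-(n * Real.log 2))) * Real.exp (n * (Real.log 2 + δ)) +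
        Real.exp (n * (Real.log 2 - ε)) * (2 * Real.exp (-(n * Real.log 2))) *
          (2 * Real.exp (-(n * Real.log 2))) * Real.exp (n * (Real.log 2 + δ)) := by
        rw [hθ, ← Real.exp_neg, neg_neg]
        gcongr
        exacts [inv_two_pow_sub_one_le hn, inv_two_pow_sub_one_le hn, inv_two_pow_sub_two_le hn]
    _ = _ := by
        have hr : Real.exp (-((r - δ) * n)) = Real.exp (-(r * n)) *
            Real.exp (-(n * Real.log 2)) * Real.exp (n * (Real.log 2 + δ)) := by
          simp only [← Real.exp_add]; ring_nf
        have hε : Real.exp (-((ε - δ) * n)) = Real.exp (n * (Real.log 2 - ε)) *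
            Real.exp (-(n * Real.log 2)) * Real.exp (-(n * Real.log 2)) *
            Real.exp (n * (Real.log 2 + δ)) := by
          simp only [← Real.exp_add]; ring_nf
        rw [hr, hε]
        ring

section Decoding

variable {S T Y : Type*} [Fintype S] [Fintype T] [Fintype Y] {σ : RandomBias S} {κ : RandomBias T}
  {W : S → ZMod 2 → Y → ℝ} {pd : Y → ℝ} {R : ℝ} {f : Query}

/-- The entropy, in nats, of the channel input relative to a bit whose bias `pd y` depends on the
channel output `y`; it is the conditional entropy of the input given the output if `pd` is the
conditional bias. -/
noncomputable def decoderCrossEntropy (σ : RandomBias S) (W : S → ZMod 2 → Y → ℝ) (pd : Y → ℝ) :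
    ℝ :=
  ∑ a, compProd σ.joint (fun sx => W sx.1 sx.2) a * -Real.log (bitMass (pd a.2) a.1.2)

lemma exists_idealExpect_le_exp (hW : IsStateChannel W)
    (hpos : ∀ s x y, σ.joint (s, x) * W s x y ≠ 0 → 0 < bitMass (pd y) x)
    (hR : 0 ≤ R) (hR1 : R < 1) {c : ℝ}
    (hc : decoderCrossEntropy σ W pd + (1 - R) * κ.entropy < c) :
    ∃ r : ℝ, 0 < r ∧ ∀ᶠ n : ℕ in atTop,
      idealExpect σ κ W (fun (q : Fin (n - ⌊n * R⌋₊) → T) v _ (x : Fin n → ZMod 2) y =>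
        ind (weight (pd ∘ y) x * weight (κ.bias ∘ q) v < Real.exp (-(n * c)))) ≤
      Real.exp (-(r * n)) := by
  simp only [idealExpect_eq_prodExpect]
  rw [← κ.crossEntropy_self] at hc
  exact exists_prodExpect_ind_mul_lt_le_exp
    (compProd_mem_stdSimplex σ.joint_mem_stdSimplex fun sx => hW sx.1 sx.2)
    κ.joint_mem_stdSimplex (fun a => hpos a.1.1 a.1.2 a.2)
    (fun _ => κ.bitMass_pos_of_joint_ne_zero) (sub_pos.2 hR1) (tendsto_sub_floor_div hR hR1.le) hc

/-- For a family of events indexed by the blocklength `n` and the message of length `⌊nR⌋`: their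
probabilities tend to `0` uniformly over the nonzero messages. -/
def VanishesUniformly (R : ℝ) (P : (n : ℕ) → (Fin ⌊n * R⌋₊ → ZMod 2) → ℝ) : Prop :=
  ∃ u : ℕ → ℝ, Tendsto u atTop (𝓝 0) ∧ ∀ᶠ n : ℕ in atTop, ∀ m, m ≠ 0 → P n m ≤ u n

lemma vanishesUniformly_msgProb_ne_decode (hf : IsQuery f) (hW : IsStateChannel W)
    (hpd : ∀ y, pd y ∈ Set.Icc (0 : ℝ) 1)
    (hpos : ∀ s x y, σ.joint (s, x) * W s x y ≠ 0 → 0 < bitMass (pd y) x)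
    (hκ : ∑ t, κ.mass t * κ.bias t = 1 / 2) (hR : 0 ≤ R) (hR1 : R < 1)
    (hrate : decoderCrossEntropy σ W pd + (1 - R) * κ.entropy < (1 - R) * Real.log 2)
    (hfail : ∀ δ > 0, FailureVanishes R δ σ κ) :
    VanishesUniformly R fun n m => msgProb σ κ W m f
      (fun (H : GL (Fin n) (ZMod 2)) q _ _ y => m ≠ decode f pd H (κ.bias ∘ q) y) := by
  obtain ⟨c, hc, hcR⟩ := exists_between hrate
  set ε := (1 - R) * Real.log 2 - c
  obtain ⟨r, hr, hideal⟩ := exists_idealExpect_le_exp hW hpos hR hR1 hc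
  obtain ⟨δ, hδ, hδmin⟩ := exists_between (lt_min hr (sub_pos.2 hcR : 0 < ε))
  obtain ⟨hδr, hδε⟩ := lt_min_iff.1 hδmin
  obtain ⟨u, hu, hfaille⟩ := hfail δ hδ
  refine ⟨fun n => u n + (2 * Real.exp (-((r - δ) * n)) + 6 * Real.exp (-((ε - δ) * n))), ?_, ?_⟩
  · simpa using hu.add (((tendsto_exp_neg_mul (sub_pos.2 hδr)).const_mul 2).add
      ((tendsto_exp_neg_mul (sub_pos.2 hδε)).const_mul 6))
  filter_upwards [hideal, hfaille, eventually_ge_atTop 2] with n hideal hfaille hn m hm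
  have hkn := floor_mul_le_self hR1.le n
  have hτ : 2 ^ ⌊n * R⌋₊ / Real.exp (-(n * c)) ≤ Real.exp (n * (Real.log 2 - ε)) := by
    have hk : ⌊n * R⌋₊ * Real.log 2 ≤ n * R * Real.log 2 := by
      gcongr
      exact Nat.floor_le (by positivity)
    rw [two_pow_eq_exp, ← Real.exp_sub, Real.exp_le_exp]
    linear_combination hk
  exact (msgProb_ne_decode_le hkn hf hW hpd hκ hn hm (Real.exp_pos _) (Real.exp_pos _)).trans
    (add_le_add (hfaille hkn m hm) (decoding_error_le hn hkn hideal hτ rfl))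

end Decoding

/-! ### Typical empirical distributions -/

section Empirical

variable {A : Type*} [Fintype A] {P : A → ℝ} {ε : ℝ}

lemma exists_prodExpect_ind_abs_sub_le_exp (hP : P ∈ stdSimplex ℝ A) (φ : A → ℝ) (hε : 0 < ε) :
    ∃ r : ℝ, 0 < r ∧ ∀ n : ℕ, prodExpect (fun _ : Fin n => P)
      (fun a => ind (n * ε ≤ |∑ i, φ (a i) - n * ∑ a, P a * φ a|)) ≤
        2 * Real.exp (-(r * n)) := by
  set μ := ∑ a, P a * φ a with hμ
  have hneg : ∑ a, P a * -φ a = -μ := by simp only [mul_neg, sum_neg_distrib, hμ]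
  obtain ⟨r₁, hr₁, h₁⟩ := exists_prodExpect_ind_le_exp hP
    (φ := φ) (c := μ + ε) (lt_add_of_pos_right μ hε)
  obtain ⟨r₂, hr₂, h₂⟩ := exists_prodExpect_ind_le_exp hP
    (φ := fun a => -φ a) (c := -μ + ε) (by rw [hneg]; exact lt_add_of_pos_right _ hε)
  refine ⟨min r₁ r₂, lt_min hr₁ hr₂, fun n => ?_⟩
  have hP' : IsKernel fun _ : Fin n => P := fun _ => hP
  calc _ ≤ prodExpect (fun _ : Fin n => P) (fun a => ind (n * (μ + ε) ≤ ∑ i, φ (a i)) +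
        ind (n * (-μ + ε) ≤ ∑ i, -φ (a i))) := by
        refine prodExpect_mono hP' fun a => (ind_mono fun h => ?_).trans (ind_or_le _ _)
        rw [sum_neg_distrib]
        exact (le_abs.1 h).imp (fun h => by linarith) fun h => by linarith
    _ ≤ Real.exp (-(r₁ * n)) + Real.exp (-(r₂ * n)) := by
        rw [prodExpect_add]
        exact add_le_add (h₁ n) (h₂ n)
    _ ≤ Real.exp (-(min r₁ r₂ * n)) + Real.exp (-(min r₁ r₂ * n)) := by
        gcongr
        exacts [min_le_left _ _, min_le_right _ _]
    _ = _ := (two_mul _).symm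

lemma ind_exists_le_sum (p : A → Prop) : ind (∃ a, p a) ≤ ∑ a, ind (p a) := by
  by_cases h : ∃ a, p a
  · obtain ⟨a, ha⟩ := id h
    rw [ind_of_true h, ← ind_of_true ha]
    exact single_le_sum (f := fun a => ind (p a)) (fun a _ => ind_nonneg (p a)) (mem_univ a)
  · rw [ind_of_false h]
    exact sum_nonneg fun a _ => ind_nonneg (p a)

lemma exists_prodExpect_ind_exists_frequency_le_exp [DecidableEq A] (hP : P ∈ stdSimplex ℝ A)
    (hε : 0 < ε) :
    ∃ r : ℝ, 0 < r ∧ ∀ n : ℕ, 0 < n → prodExpect (fun _ : Fin n => P)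
      (fun w => ind (∃ a, ε ≤ |(#{i | w i = a} : ℝ) / n - P a|)) ≤
        Fintype.card A * (2 * Real.exp (-(r * n))) := by
  choose r hr h using fun a => exists_prodExpect_ind_abs_sub_le_exp hP (Pi.single a 1) hε
  have hne : Nonempty A :=
    let ⟨a, _⟩ := exists_ne_zero_of_sum_ne_zero (hP.2.trans_ne one_ne_zero)
    ⟨a⟩
  obtain ⟨a₀, ha₀⟩ := Finite.exists_min r
  refine ⟨r a₀, hr a₀, fun n hn => ?_⟩
  have hletter (a : A) (w : Fin n → A) (hw : ε ≤ |(#{i | w i = a} : ℝ) / n - P a|) :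
      n * ε ≤ |∑ i, (Pi.single a 1 : A → ℝ) (w i) - n * ∑ b, P b * (Pi.single a 1 : A → ℝ) b| := by
    have hn' : (0 : ℝ) < n := Nat.cast_pos.2 hn
    simp only [Pi.single_apply, mul_ite, mul_one, mul_zero, sum_ite_eq', mem_univ, if_true,
      sum_boole]
    rw [← mul_div_cancel₀ (#{i | w i = a} : ℝ) hn'.ne', ← mul_sub, abs_mul, abs_of_pos hn']
    gcongr
  calc _ ≤ ∑ a, prodExpect (fun _ : Fin n => P) (fun w => ind (n * ε ≤
        |∑ i, (Pi.single a 1 : A → ℝ) (w i) - n * ∑ b, P b * (Pi.single a 1 : A → ℝ) b|)) := by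
        rw [← prodExpect_sum]
        exact prodExpect_mono (fun _ => hP) fun w => (ind_exists_le_sum _).trans
          (sum_le_sum fun a _ => ind_mono (hletter a w))
    _ ≤ ∑ _a : A, 2 * Real.exp (-(r a₀ * n)) := by
        gcongr with a
        exact (h a n).trans (by gcongr; exact ha₀ a)
    _ = _ := by rw [sum_const, card_univ, nsmul_eq_mul]

variable {S T Y : Type*} [Fintype S] [DecidableEq S] [Fintype T] [Fintype Y] {σ : RandomBias S}
  {κ : RandomBias T} {W : S → ZMod 2 → Y → ℝ} {R : ℝ} {f : Query}

lemma vanishesUniformly_msgProb_empirical (hf : IsQuery f) (hW : IsStateChannel W)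
    (hR1 : R ≤ 1) (hfail : ∀ δ > 0, FailureVanishes R δ σ κ) (hε : 0 < ε) :
    VanishesUniformly R fun n m => msgProb σ κ W m f
      (fun (_ : GL (Fin n) (ZMod 2)) _ s x _ =>
        ∃ a b, ε ≤ |empirical s x a b - σ.joint (a, b)|) := by
  obtain ⟨r, hr, hfreq⟩ := exists_prodExpect_ind_exists_frequency_le_exp σ.joint_mem_stdSimplex hε
  obtain ⟨δ, hδ, hδr⟩ := exists_between hr
  obtain ⟨u, hu, hfaille⟩ := hfail δ hδ
  set C := (Fintype.card (S × ZMod 2) : ℝ)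
  refine ⟨fun n => u n + C * (4 * Real.exp (-((r - δ) * n))), ?_, ?_⟩
  · simpa using hu.add (((tendsto_exp_neg_mul (sub_pos.2 hδr)).const_mul 4).const_mul C)
  filter_upwards [hfaille, eventually_ge_atTop 2] with n hfaille hn m hm
  have hkn := floor_mul_le_self hR1 n
  refine (msgProb_le_failProb_add_idealExpect hkn hf hW (Real.exp_pos _) hn hm fun s x =>
    ∃ a b, ε ≤ |empirical s x a b - σ.joint (a, b)|).trans
      (add_le_add (hfaille hkn m hm) ?_)
  have hpairs := hfreq n (by omega)
  simp only [Prod.exists, Prod.ext_iff] at hpairs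
  calc _ ≤ (C * (2 * Real.exp (-(r * n)))) *
        ((2 * Real.exp (-(n * Real.log 2))) * Real.exp (n * (Real.log 2 + δ))) := by
        rw [div_eq_mul_inv, mul_inv, ← Real.exp_neg, neg_neg]
        refine mul_le_mul hpairs ?_ ?_ (by positivity)
        · gcongr
          exact inv_two_pow_sub_one_le hn
        · have := four_le_two_pow hn
          have : (0 : ℝ) ≤ (2 ^ n - 1)⁻¹ := inv_nonneg.2 (by linarith)
          positivity
    _ = C * (4 * (Real.exp (-(r * n)) * Real.exp (-(n * Real.log 2)) *
          Real.exp (n * (Real.log 2 + δ)))) := by ring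
    _ = _ := by
        simp only [← Real.exp_add]
        ring_nf

end Empirical

/-! ### Weighted parity-check codes -/

lemma sum_piFinset_const {ι A M : Type*} [Fintype ι] [DecidableEq ι] [AddCommMonoid M]
    (s : Finset A) (F : (ι → A) → M) :
    ∑ q ∈ Fintype.piFinset (fun _ : ι => s), F q = ∑ q : ι → s, F (Subtype.val ∘ q) := by
  let e := (Equiv.subtypeEquivRight fun _ => Fintype.mem_piFinset).trans
    (Equiv.subtypePiEquivPi (p := fun (_ : ι) a => a ∈ s))
  exact (sum_coe_sort _ F).symm.trans (Fintype.sum_equiv e _ _ fun _ => rfl)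

section ParityBias

variable {PQ : ℝ →₀ ℝ} (hPQ : IsParityBias PQ)

/-- The parity bits of the code: the letters are the biases of positive probability. -/
noncomputable def IsParityBias.randomBias : RandomBias PQ.support where
  mass q := PQ q
  bias q := q
  mass_mem := ⟨fun q => hPQ.nonneg q, (sum_coe_sort PQ.support PQ).trans hPQ.sum_eq_one⟩
  bias_mem q := hPQ.support_subset q q.2

lemma IsParityBias.sum_mul_bias :
    ∑ q, hPQ.randomBias.mass q * hPQ.randomBias.bias q = 1 / 2 := by
  have hsymm : ∑ q ∈ PQ.support, PQ q * (1 - q) = ∑ q ∈ PQ.support, PQ q * q := by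
    have hmem (q : ℝ) (hq : q ∈ PQ.support) : 1 - q ∈ PQ.support := by
      rwa [Finsupp.mem_support_iff, hPQ.symm, ← Finsupp.mem_support_iff]
    refine sum_nbij' (1 - ·) (1 - ·) hmem hmem (fun q _ => sub_sub_cancel 1 q)
      (fun q _ => sub_sub_cancel 1 q) fun q _ => ?_
    rw [hPQ.symm]
  simp only [mul_sub, mul_one, sum_sub_distrib, hPQ.sum_eq_one] at hsymm
  have hcoe := sum_coe_sort PQ.support fun q => PQ q * q
  refine hcoe.trans ?_
  linarith

lemma IsParityBias.entropy_randomBias :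
    hPQ.randomBias.entropy = meanBinEntropy PQ * Real.log 2 := by
  have hlog : Real.log 2 ≠ 0 := (Real.log_pos one_lt_two).ne'
  rw [meanBinEntropy, sum_mul]
  simp only [mul_assoc, div_mul_cancel₀ _ hlog]
  exact sum_coe_sort PQ.support fun q => PQ q * Real.binEntropy q

end ParityBias

section CodeProb

variable {S Y : Type*} [Fintype S] [Fintype Y] {σ : RandomBias S} {W : S → ZMod 2 → Y → ℝ}
  {PQ : ℝ →₀ ℝ} {pd : Y → ℝ} {f : Query}

lemma codeProb_eq_expect_msgProb (hPQ : IsParityBias PQ) {n k : ℕ}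
    (E : (Fin k → ZMod 2) → (Fin k → ZMod 2) → (Fin n → S) → (Fin n → ZMod 2) → Prop) :
    codeProb f σ.mass W PQ σ.bias pd n k E = 𝔼 m, msgProb σ hPQ.randomBias W m f
      (fun (H : GL (Fin n) (ZMod 2)) q s x y =>
        E m (decode f pd H (hPQ.randomBias.bias ∘ q) y) s x) := by
  have hcard : (Fintype.card (Fin k → ZMod 2) : ℝ) = 2 ^ k := by simp
  simp only [codeProb, ← ind_eq_ite, sum_piFinset_const, msgProb, prodExpect,
    Fintype.expect_eq_sum_div_card, hcard]
  simp only [div_eq_mul_inv, sum_mul, mul_sum, one_mul]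
  refine sum_congr rfl fun m _ => ?_
  rw [sum_comm_cycle]
  refine sum_congr rfl fun s _ => ?_
  rw [sum_comm]
  refine sum_congr rfl fun q _ => sum_congr rfl fun H _ => sum_congr rfl fun y _ => ?_
  simp only [IsParityBias.randomBias, Function.comp_def]
  ring

lemma msgProb_nonneg {T : Type*} [Fintype T] {κ : RandomBias T} (hW : IsStateChannel W) {n k : ℕ}
    {m : Fin k → ZMod 2} {E : GL (Fin n) (ZMod 2) → (Fin (n - k) → T) → (Fin n → S) →
      (Fin n → ZMod 2) → (Fin n → Y) → Prop} : 0 ≤ msgProb σ κ W m f E :=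
  prodExpect_nonneg σ.isKernel_mass fun _ => prodExpect_nonneg κ.isKernel_mass fun _ =>
    expect_nonneg fun _ _ => prodExpect_nonneg (hW.isKernel _ _) fun _ => ind_nonneg _

lemma msgProb_le_one {T : Type*} [Fintype T] {κ : RandomBias T} (hW : IsStateChannel W) {n k : ℕ}
    {m : Fin k → ZMod 2} {E : GL (Fin n) (ZMod 2) → (Fin (n - k) → T) → (Fin n → S) →
      (Fin n → ZMod 2) → (Fin n → Y) → Prop} : msgProb σ κ W m f E ≤ 1 :=
  prodExpect_le_of_forall_le σ.isKernel_mass fun _ =>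
    prodExpect_le_of_forall_le κ.isKernel_mass fun _ =>
      expect_le univ_nonempty fun _ _ =>
        prodExpect_le_of_forall_le (hW.isKernel _ _) fun _ => ind_le_one _

lemma VanishesUniformly.tendsto_expect {R : ℝ} (hR : 0 < R)
    {P : (n : ℕ) → (Fin ⌊n * R⌋₊ → ZMod 2) → ℝ} (h : VanishesUniformly R P)
    (h0 : ∀ n m, 0 ≤ P n m) (h1 : ∀ n m, P n m ≤ 1) :
    Tendsto (fun n : ℕ => 𝔼 m, P n m) atTop (𝓝 0) := by
  obtain ⟨u, hu, hle⟩ := h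
  have hfloor : Tendsto (fun n : ℕ => ⌊n * R⌋₊) atTop atTop :=
    tendsto_nat_floor_atTop.comp (tendsto_natCast_atTop_atTop.atTop_mul_const hR)
  have hpow : Tendsto (fun n : ℕ => (1 / 2 : ℝ) ^ ⌊n * R⌋₊) atTop (𝓝 0) :=
    (tendsto_pow_atTop_nhds_zero_of_lt_one (by norm_num) (by norm_num)).comp hfloor
  refine squeeze_zero' (Eventually.of_forall fun n => expect_nonneg fun m _ => h0 n m)
    (g := fun n : ℕ => (1 / 2 : ℝ) ^ ⌊n * R⌋₊ + |u n|) ?_ (by simpa using hpow.add hu.abs)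
  filter_upwards [hle] with n hle
  have hle_ite (m : Fin ⌊n * R⌋₊ → ZMod 2) : P n m ≤ (if m = 0 then 1 else 0) + |u n| := by
    split_ifs with hm
    · exact (h1 n m).trans (le_add_of_nonneg_right (abs_nonneg _))
    · exact (hle m hm).trans ((le_abs_self _).trans_eq (zero_add _).symm)
  refine (expect_le_expect fun m _ => hle_ite m).trans_eq ?_
  rw [expect_add_distrib, Fintype.expect_const, Fintype.expect_eq_sum_div_card, sum_ite_eq',
    if_pos (mem_univ _)]
  simp only [Fintype.card_pi_const, ZMod.card, Nat.cast_pow, Nat.cast_ofNat, one_div, inv_pow]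

lemma tendsto_codeProb (hPQ : IsParityBias PQ) (hW : IsStateChannel W) {R : ℝ} (hR : 0 < R)
    {E : (n : ℕ) → (Fin ⌊n * R⌋₊ → ZMod 2) → (Fin ⌊n * R⌋₊ → ZMod 2) → (Fin n → S) →
      (Fin n → ZMod 2) → Prop}
    (h : VanishesUniformly R fun n m => msgProb σ hPQ.randomBias W m f
      fun (H : GL (Fin n) (ZMod 2)) q s x y =>
        E n m (decode f pd H (hPQ.randomBias.bias ∘ q) y) s x) :
    Tendsto (fun n : ℕ => codeProb f σ.mass W PQ σ.bias pd n ⌊n * R⌋₊ (E n)) atTop (𝓝 0) := by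
  simp only [codeProb_eq_expect_msgProb hPQ]
  exact h.tendsto_expect hR (fun _ _ => msgProb_nonneg hW) fun _ _ => msgProb_le_one hW

end CodeProb

section Reliable

variable {S Y : Type*} [Fintype S] [Fintype Y] {PS : S → ℝ} {PX : S → ZMod 2 → ℝ}
  {W : S → ZMod 2 → Y → ℝ} {PQ : ℝ →₀ ℝ} {R : ℝ}

/-- The codeword bits of the code: the letters are the states, with biases `P_{X|S}(1|s)`. -/
def stateBias (hPS : PS ∈ stdSimplex ℝ S) (hPX : IsKernel PX) : RandomBias S where
  mass := PS
  bias := encBias PX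
  mass_mem := hPS
  bias_mem s := apply_one_mem_Icc (hPX s)

lemma joint_stateBias (hPS : PS ∈ stdSimplex ℝ S) (hPX : IsKernel PX) (a : S) (b : ZMod 2) :
    (stateBias hPS hPX).joint (a, b) = PS a * PX a b :=
  congrArg (PS a * ·) (bitMass_apply_one (hPX a) b)

lemma entropy_stateBias (hPS : PS ∈ stdSimplex ℝ S) (hPX : IsKernel PX) :
    (stateBias hPS hPX).entropy = condEntropy PS PX * Real.log 2 :=
  (condEntropy_mul_log_two hPX).symm

lemma decoderCrossEntropy_stateBias (hPS : PS ∈ stdSimplex ℝ S) (hPX : IsKernel PX) :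
    decoderCrossEntropy (stateBias hPS hPX) W (decBias PS PX W) = outputCondEntropy PS PX W := by
  simp only [decoderCrossEntropy, outputCondEntropy, jointXY, compProd, Fintype.sum_prod_type,
    joint_stateBias, sum_mul]
  rw [sum_comm]
  exact sum_congr rfl fun x _ => sum_comm

lemma condEntropy_le_one (hPS : PS ∈ stdSimplex ℝ S) (hPX : IsKernel PX) :
    condEntropy PS PX ≤ 1 := by
  refine le_of_mul_le_mul_right ?_ (Real.log_pos one_lt_two)
  calc condEntropy PS PX * Real.log 2 = ∑ s, PS s * Real.binEntropy (PX s 1) :=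
        condEntropy_mul_log_two hPX
    _ ≤ ∑ s, PS s * Real.log 2 := sum_le_sum fun s _ =>
        mul_le_mul_of_nonneg_left Real.binEntropy_le_log_two (hPS.1 s)
    _ = 1 * Real.log 2 := by rw [← sum_mul, hPS.2]

lemma gpRate_le_condEntropy (hPS : PS ∈ stdSimplex ℝ S) (hPX : IsKernel PX)
    (hW : IsStateChannel W) : gpRate PS PX W ≤ condEntropy PS PX := by
  refine le_of_mul_le_mul_right ?_ (Real.log_pos one_lt_two)
  rw [gpRate_mul_log_two hPS hPX hW]
  exact sub_le_self _ (outputCondEntropy_nonneg hPS hPX hW)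

lemma failureVanishes_of_nonDegenerate (hPS : PS ∈ stdSimplex ℝ S) (hPX : IsKernel PX)
    (hPQ : IsParityBias PQ) (hnd : NonDegenerate PS PX PQ) (hR : 0 ≤ R) (hR1 : R < 1)
    (hQ : meanBinEntropy PQ = (1 - condEntropy PS PX) / (1 - R)) {δ : ℝ} (hδ : 0 < δ) :
    FailureVanishes R δ (stateBias hPS hPX) hPQ.randomBias := by
  refine failureVanishes hR hR1 hδ ?_ (hnd.imp_right (Or.imp_left ?_))
  · rw [entropy_stateBias, hPQ.entropy_randomBias, hQ]
    have : 1 - R ≠ 0 := (sub_pos.2 hR1).ne'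
    field_simp
    ring
  · rintro ⟨q, hq, hne⟩
    exact ⟨⟨q, hq⟩, Finsupp.mem_support_iff.1 hq, hne⟩

lemma reliable_of_lt_gpRate [DecidableEq S] (hPS : PS ∈ stdSimplex ℝ S) (hPX : IsKernel PX)
    (hW : IsStateChannel W) (hPQ : IsParityBias PQ) (hnd : NonDegenerate PS PX PQ) (hR : 0 < R)
    (hQ : meanBinEntropy PQ = (1 - condEntropy PS PX) / (1 - R)) (hrate : R < gpRate PS PX W) :
    Reliable R PS PX W PQ := by
  have hR1 : R < 1 := hrate.trans_le
    ((gpRate_le_condEntropy hPS hPX hW).trans (condEntropy_le_one hPS hPX))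
  have hfail (δ : ℝ) (hδ : δ > 0) :=
    failureVanishes_of_nonDegenerate hPS hPX hPQ hnd hR.le hR1 hQ hδ
  have hpos (s : S) (x : ZMod 2) (y : Y) (h : (stateBias hPS hPX).joint (s, x) * W s x y ≠ 0) :
      0 < bitMass (decBias PS PX W y) x :=
    bitMass_decBias_pos hPS hPX hW
      (jointXY_ne_zero hPS hPX hW (by rwa [joint_stateBias] at h))
  have hdec : decoderCrossEntropy (stateBias hPS hPX) W (decBias PS PX W) +
      (1 - R) * hPQ.randomBias.entropy < (1 - R) * Real.log 2 := by
    have hgap := mul_lt_mul_of_pos_right hrate (Real.log_pos one_lt_two)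
    rw [gpRate_mul_log_two hPS hPX hW] at hgap
    rw [decoderCrossEntropy_stateBias, hPQ.entropy_randomBias, hQ, ← mul_assoc,
      mul_div_cancel₀ _ (sub_pos.2 hR1).ne']
    linear_combination hgap
  refine fun f hf => ⟨tendsto_codeProb (σ := stateBias hPS hPX) hPQ hW hR ?_, fun ε hε =>
    tendsto_codeProb (σ := stateBias hPS hPX) hPQ hW hR ?_⟩
  · exact vanishesUniformly_msgProb_ne_decode hf hW (decBias_mem hPS hPX hW) hpos
      hPQ.sum_mul_bias hR.le hR1 hdec hfail
  · simpa only [joint_stateBias] using vanishesUniformly_msgProb_empirical hf hW hR1.le hfail hε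

end Reliable

section TwoPoint

variable {a : ℝ}

/-- The uniform distribution on `{a, 1 - a}`, the simplest parity bias of a given entropy. At
`a = 1 / 2` the two masses add up to the point mass. -/
noncomputable def twoPoint (a : ℝ) : ℝ →₀ ℝ :=
  Finsupp.single a (1 / 2) + Finsupp.single (1 - a) (1 / 2)

lemma twoPoint_apply (a q : ℝ) :
    twoPoint a q = (if a = q then 1 / 2 else 0) + (if 1 - a = q then 1 / 2 else 0) := by
  classical
  simp only [twoPoint, Finsupp.add_apply, Finsupp.single_apply]

lemma twoPoint_nonneg (a q : ℝ) : 0 ≤ twoPoint a q := by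
  rw [twoPoint_apply]
  positivity

lemma mem_support_twoPoint {q : ℝ} : q ∈ (twoPoint a).support ↔ q = a ∨ q = 1 - a := by
  rw [Finsupp.mem_support_iff, twoPoint_apply, eq_comm (a := q), eq_comm (a := q)]
  split_ifs <;> simp_all

lemma sum_support_twoPoint (a : ℝ) (g : ℝ → ℝ) :
    ∑ q ∈ (twoPoint a).support, twoPoint a q * g q = (g a + g (1 - a)) / 2 := by
  calc ∑ q ∈ (twoPoint a).support, twoPoint a q * g q = (twoPoint a).sum fun q c => c * g q := rfl
    _ = 1 / 2 * g a + 1 / 2 * g (1 - a) := by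
        rw [twoPoint, Finsupp.sum_add_index' (fun q => zero_mul _) fun q c d => add_mul c d _,
          Finsupp.sum_single_index (zero_mul _), Finsupp.sum_single_index (zero_mul _)]
    _ = (g a + g (1 - a)) / 2 := by ring

lemma isParityBias_twoPoint (ha : a ∈ Set.Icc (0 : ℝ) 1) : IsParityBias (twoPoint a) where
  nonneg := twoPoint_nonneg a
  support_subset q hq := by
    obtain rfl | rfl := mem_support_twoPoint.1 hq
    · exact ha
    · exact Set.Icc.mem_iff_one_sub_mem.1 ha
  sum_eq_one := by simpa using sum_support_twoPoint a fun _ => 1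
  symm q := by
    have hflip : a = 1 - q ↔ 1 - a = q := by constructor <;> intro h <;> linarith
    rw [twoPoint_apply, twoPoint_apply, add_comm]
    simp only [hflip, sub_right_inj]

lemma meanBinEntropy_twoPoint (a : ℝ) :
    meanBinEntropy (twoPoint a) = Real.binEntropy a / Real.log 2 := by
  rw [meanBinEntropy, sum_support_twoPoint, Real.binEntropy_one_sub, add_self_div_two]

end TwoPoint

lemma exists_binEntropy_eq {h : ℝ} (hh : h ∈ Set.Icc 0 (Real.log 2)) :
    ∃ a ∈ Set.Icc (0 : ℝ) 1, Real.binEntropy a = h := by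
  have hivt := intermediate_value_Icc (inv_nonneg.2 zero_le_two : (0 : ℝ) ≤ 2⁻¹)
    Real.binEntropy_continuous.continuousOn
  rw [Real.binEntropy_zero, Real.binEntropy_two_inv] at hivt
  obtain ⟨a, ha, hah⟩ := hivt hh
  exact ⟨a, ⟨ha.1, ha.2.trans two_inv_lt_one.le⟩, hah⟩

section Reliable

variable {S Y : Type*} [Fintype S] {PS : S → ℝ} {PX : S → ZMod 2 → ℝ} {R : ℝ}

lemma apply_one_notMem_of_condEntropy_eq_one (hPS : PS ∈ stdSimplex ℝ S) (hPX : IsKernel PX)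
    (hH : condEntropy PS PX = 1) {s : S} (hs : PS s ≠ 0) : PX s 1 ∉ ({0, 1} : Set ℝ) := by
  have hdeficit : ∑ s, PS s * (Real.log 2 - Real.binEntropy (PX s 1)) = 0 := by
    simp only [mul_sub, sum_sub_distrib, ← sum_mul, hPS.2, ← condEntropy_mul_log_two hPX, hH,
      sub_self]
  have hs0 := (sum_eq_zero_iff_of_nonneg fun s _ => mul_nonneg (hPS.1 s)
    (sub_nonneg.2 Real.binEntropy_le_log_two)).1 hdeficit s (mem_univ s)
  have hmax := sub_eq_zero.1 ((mul_eq_zero.1 hs0).resolve_left hs)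
  intro hmem
  rw [Real.binEntropy_eq_zero.2 hmem] at hmax
  exact (Real.log_pos one_lt_two).ne' hmax

lemma exists_parityBias (hPS : PS ∈ stdSimplex ℝ S) (hPX : IsKernel PX)
    (hR : R < condEntropy PS PX) :
    ∃ PQ, IsParityBias PQ ∧ meanBinEntropy PQ = (1 - condEntropy PS PX) / (1 - R) ∧
      NonDegenerate PS PX PQ := by
  have hlog := Real.log_pos one_lt_two
  have hH := condEntropy_le_one hPS hPX
  have hR1 : 0 < 1 - R := sub_pos.2 (hR.trans_le hH)
  set c := (1 - condEntropy PS PX) / (1 - R) with hc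
  have hc0 : 0 ≤ c := div_nonneg (sub_nonneg.2 hH) hR1.le
  have hc1 : c < 1 := (div_lt_one hR1).2 (sub_lt_sub_left hR 1)
  obtain ⟨a, ha, hac⟩ := exists_binEntropy_eq
    ⟨mul_nonneg hc0 hlog.le, mul_le_of_le_one_left hlog.le hc1.le⟩
  refine ⟨twoPoint a, isParityBias_twoPoint ha, ?_, Or.inr ?_⟩
  · rw [meanBinEntropy_twoPoint, hac, mul_div_cancel_right₀ _ hlog.ne']
  obtain hcz | hcz := hc0.eq_or_lt
  · have hH1 : condEntropy PS PX = 1 := by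
      rw [hc, eq_comm, div_eq_zero_iff, or_iff_left hR1.ne', sub_eq_zero] at hcz
      exact hcz.symm
    exact Or.inr fun s hs => apply_one_notMem_of_condEntropy_eq_one hPS hPX hH1 hs
  · refine Or.inl ⟨a, mem_support_twoPoint.2 (Or.inl rfl), ?_⟩
    rintro (rfl | rfl | rfl)
    · exact (mul_pos hcz hlog).ne (Real.binEntropy_zero.symm.trans hac)
    · rw [one_div, Real.binEntropy_two_inv] at hac
      exact (mul_lt_of_lt_one_left hlog hc1).ne' hac
    · exact (mul_pos hcz hlog).ne (Real.binEntropy_one.symm.trans hac)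

lemma exists_parityBias_reliable [DecidableEq S] [Fintype Y] {W : S → ZMod 2 → Y → ℝ}
    (hPS : PS ∈ stdSimplex ℝ S) (hPX : IsKernel PX) (hW : IsStateChannel W) (hR : 0 < R)
    (hrate : R < gpRate PS PX W) :
    ∃ PQ, IsParityBias PQ ∧ meanBinEntropy PQ = (1 - condEntropy PS PX) / (1 - R) ∧
      Reliable R PS PX W PQ := by
  obtain ⟨PQ, hPQ, hQ, hnd⟩ :=
    exists_parityBias hPS hPX (hrate.trans_le (gpRate_le_condEntropy hPS hPX hW))
  exact ⟨PQ, hPQ, hQ, reliable_of_lt_gpRate hPS hPX hW hPQ hnd hR hQ hrate⟩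

end Reliable

lemma exists_lt_of_pos_of_lt_sSup {s : Set ℝ} {r : ℝ} (hr : 0 < r) (h : r < sSup s) :
    ∃ x ∈ s, r < x := by
  refine exists_lt_of_lt_csSup (Set.nonempty_iff_ne_empty.2 fun hs => ?_) h
  rw [hs, Real.sSup_empty] at h
  exact hr.not_gt h

section Stateless

variable {U Y : Type*} [Fintype U]

lemma one_mem_stdSimplex_unit : (fun _ : Unit => (1 : ℝ)) ∈ stdSimplex ℝ Unit :=
  ⟨fun _ => zero_le_one, Fintype.sum_unique _⟩

lemma condEntropy_unit (p : U → ℝ) :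
    condEntropy (fun _ : Unit => 1) (fun _ => p) = entropy p := by
  rw [condEntropy, Fintype.sum_unique, one_mul]

lemma gpRate_unit [Fintype Y] {p : U → ℝ} (hp : p ∈ stdSimplex ℝ U) (W : U → Y → ℝ) :
    gpRate (fun _ : Unit => 1) (fun _ => p) (fun _ => W) = mutualInfo fun x y => p x * W x y := by
  have hXS : mutualInfo (jointXS (fun _ : Unit => (1 : ℝ)) fun _ => p) = 0 := by
    rw [mutualInfo, entropy_jointXS fun _ => hp, condEntropy_unit]
    simp only [jointXS, Fintype.sum_unique, one_mul, hp.2]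
    ring
  have hXY : jointXY (fun _ : Unit => (1 : ℝ)) (fun _ => p) (fun _ => W) = fun x y => p x * W x y :=
    funext₂ fun x y => by simp only [jointXY, Fintype.sum_unique, one_mul]
  rw [gpRate, hXS, hXY, sub_zero]

end Stateless

end WPC

theorem mainTheorem2 {S A Y : Type*} [Fintype S] [DecidableEq S] [Fintype Y]
    (PS : S → ℝ) (hPS : PS ∈ stdSimplex ℝ S) (R : ℝ) (hR : 0 < R) :
    -- the code with given `P_{X|S}` and `P_Q`
    (∀ (PX : S → ZMod 2 → ℝ) (W : S → ZMod 2 → Y → ℝ) (PQ : ℝ →₀ ℝ),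
      WPC.IsKernel PX → WPC.IsStateChannel W → WPC.IsParityBias PQ →
      WPC.NonDegenerate PS PX PQ →
      WPC.meanBinEntropy PQ = (1 - WPC.condEntropy PS PX) / (1 - R) →
      R < WPC.mutualInfo (WPC.jointXY PS PX W) - WPC.mutualInfo (WPC.jointXS PS PX) →
      WPC.Reliable R PS PX W PQ) ∧
    -- every rate below the Gelfand–Pinsker expression with binary auxiliary is achieved
    (∀ W : S → A → Y → ℝ, WPC.IsStateChannel W → R < WPC.gelfandPinsker (ZMod 2) PS W →
      ∃ (PU : S → ZMod 2 → ℝ) (g : ZMod 2 → S → A) (PQ : ℝ →₀ ℝ),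
        WPC.IsKernel PU ∧ WPC.IsParityBias PQ ∧
        WPC.meanBinEntropy PQ = (1 - WPC.condEntropy PS PU) / (1 - R) ∧
        WPC.Reliable R PS PU (WPC.auxChannel W g) PQ) ∧
    -- every rate below the capacity of a binary-input channel without state is achieved
    (∀ W : ZMod 2 → Y → ℝ, WPC.IsKernel W → R < WPC.shannonCapacity W →
      ∃ (PX : ZMod 2 → ℝ) (PQ : ℝ →₀ ℝ),
        PX ∈ stdSimplex ℝ (ZMod 2) ∧ WPC.IsParityBias PQ ∧
        WPC.meanBinEntropy PQ = (1 - WPC.entropy PX) / (1 - R) ∧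
        WPC.Reliable R (fun _ : Unit => 1) (fun _ => PX) (fun _ => W) PQ) := by
  refine ⟨fun PX W PQ hPX hW hPQ hnd hQ hrate =>
      WPC.reliable_of_lt_gpRate hPS hPX hW hPQ hnd hR hQ hrate,
    fun W hW hlt => ?_, fun W hW hlt => ?_⟩
  · obtain ⟨_, ⟨PU, g, hPU, rfl⟩, hrate⟩ := WPC.exists_lt_of_pos_of_lt_sSup hR hlt
    obtain ⟨PQ, hPQ⟩ :=
      WPC.exists_parityBias_reliable hPS hPU (fun s u => hW s (g u s)) hR hrate
    exact ⟨PU, g, PQ, hPU, hPQ⟩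
  · obtain ⟨_, ⟨PX, hPX, rfl⟩, hrate⟩ := WPC.exists_lt_of_pos_of_lt_sSup hR hlt
    rw [← WPC.gpRate_unit hPX] at hrate
    obtain ⟨PQ, hPQ⟩ := WPC.exists_parityBias_reliable WPC.one_mem_stdSimplex_unit
      (fun _ => hPX) (fun _ => hW) hR hrate
    rw [WPC.condEntropy_unit] at hPQ
    exact ⟨PX, PQ, hPX, hPQ⟩
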